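/- Let $A$ be a simple, unital, exact and stably finite C$^*$-algebra. Notation. For positive $a,b$ in $M_\infty(A)=\bigcup_n M_n(A)$ write $a\precsim b$ if $\|v_kbv_k^*-a\|\to 0$ for some sequence $(v_k)$ in $M_\infty(A)$, and $a\sim b$ if $a\precsim b\precsim a$. The Cuntz semigroup is $W(A)=M_\infty(A)_+/\!\sim$, with $\langle a\rangle+\langle b\rangle=\langle a\oplus b\rangle$ and $\langle a\rangle\le\langle b\rangle\Leftrightarrow a\precsim b$. The set $\mathrm{DF}(A)$ of dimension functions consists of the additive, order preserving maps $s\colon W(A)\to[0,\infty)$ with $s(\langle 1_A\rangle)=1$, and carries the topology of pointwise convergence. For a tracial state or, more generally, a normalised 2-quasitrace $\tau$ on $A$, extended to the algebras $M_n(A)$, put $d_\tau(a)=\lim_k\tau(a^{1/k})$ for $a\in M_\infty(A)_+$; this depends only on $\langle a\rangle$. The set $\mathrm{LDF}(A)\subseteq\mathrm{DF}(A)$ of lower semicontinuous dimension functions consists of the maps $\langle a\rangle\mapsto d_\tau(a)$, where $\tau$ runs through the normalised 2-quasitraces on $A$. Let $V(A)$ be the semigroup of Murray–von Neumann classes of projections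 in $M_\infty(A)$, let $T(A)$ be the space of tracial states with the weak-$*$ topology, and let $\mathrm{LAff}_b(T(A))^{++}$ be the set of bounded, strictly positive, lower semicontinuous, affine functions on $T(A)$. Let $\widetilde W(A)=V(A)\sqcup\mathrm{LAff}_b(T(A))^{++}$, with the usual order on $V(A)$, the pointwise order on $\mathrm{LAff}_b(T(A))^{++}$ and, for $x\in V(A)$ and $y\in\mathrm{LAff}_b(T(A))^{++}$, $x\le y$ iff $\tau(x)<y(\tau)$ for all $\tau\in T(A)$, and $y\le x$ iff $y(\tau)\le\tau(x)$ for all $\tau\in T(A)$. The canonical map $\varphi\colon W(A)\to\widetilde W(A)$ sends $\langle p\rangle$ to $[p]\in V(A)$ for every projection $p$, and sends $\langle a\rangle$ to the function $\tau\mapsto d_\tau(a)$ if $a$ is not Cuntz equivalent to a projection. Theorem. If $\varphi\colon W(A)\to\widetilde W(A)$ is an order embedding, i.e. $x\le y\Leftrightarrow\varphi(x)\le\varphi(y)$ for all $x,y\in W(A)$, then $\mathrm{LDF}(A)$ is dense in $\mathrm{DF}(A)$. -/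

import Mathlib

namespace Cuntz

open Filter Topology
open scoped ComplexOrder NNReal

/-! ### Hypotheses on the algebra -/

/-- A unital C⋆-algebra is simple if it is nonzero and has no closed two-sided ideals other than
zero and the whole algebra. -/
class IsSimple (A : Type*) [CStarAlgebra A] : Prop where
  nontrivial : Nontrivial A
  eq_bot_or_eq_top : ∀ I : TwoSidedIdeal A, IsClosed (I : Set A) → I = ⊥ ∨ I = ⊤

/-- The C⋆-algebra `Mₙ(A)`, with its C⋆-norm and its C⋆-algebra order. -/
abbrev M (n : ℕ) (A : Type*) : Type _ := CStarMatrix (Fin n) (Fin n) A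

/-- A unital C⋆-algebra is stably finite if in every matrix algebra over it all isometries are
unitary. -/
def IsStablyFinite (A : Type*) [CStarAlgebra A] : Prop :=
  ∀ (n : ℕ) (v : M n A), star v * v = 1 → v * star v = 1

/-- A C⋆-algebra is exact if it has a faithful nuclear representation on a Hilbert space: one that
can be approximated, in norm on finite sets, by compositions of completely positive contractions
through matrix algebras. -/
def IsExact.{u} (A : Type u) [CStarAlgebra A] [PartialOrder A] [StarOrderedRing A] : Prop :=
  ∃ (H : Type u) (_ : NormedAddCommGroup H) (_ : InnerProductSpace ℂ H) (_ : CompleteSpace H)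
    (π : A →⋆ₙₐ[ℂ] (H →L[ℂ] H)), Function.Injective π ∧
      ∀ (F : Finset A) (ε : ℝ), 0 < ε →
        ∃ (k : ℕ) (α : CompletelyPositiveMap A (M k ℂ))
          (β : CompletelyPositiveMap (M k ℂ) (H →L[ℂ] H)),
          (∀ x, ‖α x‖ ≤ ‖x‖) ∧ (∀ y, ‖β y‖ ≤ ‖y‖) ∧ ∀ a ∈ F, ‖β (α a) - π a‖ < ε

set_option linter.unusedSectionVars false

variable {A : Type*} [CStarAlgebra A] [PartialOrder A] [StarOrderedRing A]

/-- The `k`-th root `a ^ (1 / k)` of a positive element, by functional calculus. -/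
noncomputable def root {B : Type*} [CStarAlgebra B] [PartialOrder B] [StarOrderedRing B]
    (k : ℕ) (a : B) : B :=
  a ^ (1 / (k : ℝ≥0))

/-! ### The Cuntz semigroup -/

variable (A) in
/-- Positive elements of matrix algebras over `A`. An element of `M_∞(A)₊` is represented by an
element of some `Mₙ(A)₊`; the corner embeddings identify elements which are Cuntz equivalent. -/
def Pos : Type _ := Σ n : ℕ, {a : M n A // 0 ≤ a}

/-- Cuntz subequivalence `a ≾ b`: there is a sequence `vₖ` with `‖vₖ b vₖ* - a‖ → 0`. For
`a ∈ Mₙ(A)` and `b ∈ Mₘ(A)`, viewed in upper left corners of `M_∞(A)`, only the upper left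
`n × m` block of `vₖ` matters. -/
def CuntzLE (a b : Pos A) : Prop :=
  ∃ v : ℕ → CStarMatrix (Fin a.1) (Fin b.1) A,
    Tendsto (fun k => ‖v k * (b.2 : M b.1 A) * (v k).conjTranspose - (a.2 : M a.1 A)‖)
      atTop (𝓝 0)

lemma continuous_mul_mul {n m : ℕ} (v : CStarMatrix (Fin n) (Fin m) A) :
    Continuous fun b : M m A => v * b * v.conjTranspose := by
  have key : ∀ w : Matrix (Fin n) (Fin m) A,
      Continuous fun b : Matrix (Fin m) (Fin m) A => w * b * w.conjTranspose := by
    intro w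
    fun_prop
  exact key v

lemma cuntzLE_iff (a b : Pos A) : CuntzLE a b ↔ (a.2 : M a.1 A) ∈ closure
    (Set.range fun v : CStarMatrix (Fin a.1) (Fin b.1) A =>
      v * (b.2 : M b.1 A) * v.conjTranspose) := by
  rw [mem_closure_iff_seq_limit]
  constructor
  · rintro ⟨v, hv⟩
    exact ⟨fun k => v k * (b.2 : M b.1 A) * (v k).conjTranspose, fun k => ⟨v k, rfl⟩,
      tendsto_iff_norm_sub_tendsto_zero.2 hv⟩
  · rintro ⟨x, hx, hlim⟩
    choose v hv using hx
    refine ⟨v, ?_⟩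
    have := tendsto_iff_norm_sub_tendsto_zero.1 hlim
    simpa only [← hv] using this

lemma CuntzLE.refl (a : Pos A) : CuntzLE a a := by
  rw [cuntzLE_iff]
  refine subset_closure ⟨(1 : M a.1 A), ?_⟩
  change (1 : M a.1 A) * (a.2 : M a.1 A) * star (1 : M a.1 A) = (a.2 : M a.1 A)
  rw [star_one, mul_one, one_mul]

lemma CuntzLE.trans {a b c : Pos A} (h₁ : CuntzLE a b) (h₂ : CuntzLE b c) : CuntzLE a c := by
  rw [cuntzLE_iff] at *
  refine closure_minimal ?_ isClosed_closure h₁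
  rintro _ ⟨v, rfl⟩
  refine map_mem_closure (f := fun b : M b.1 A => v * b * v.conjTranspose)
    (continuous_mul_mul v) h₂ ?_
  rintro _ ⟨w, rfl⟩
  have key : ∀ (v : Matrix (Fin a.1) (Fin b.1) A) (w : Matrix (Fin b.1) (Fin c.1) A)
      (x : Matrix (Fin c.1) (Fin c.1) A),
      v * w * x * (v * w).conjTranspose = v * (w * x * w.conjTranspose) * v.conjTranspose := by
    intro v w x
    simp only [Matrix.conjTranspose_mul, Matrix.mul_assoc]
  exact ⟨v * w, key v w _⟩

/-- Cuntz equivalence. -/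
instance cuntzSetoid : Setoid (Pos A) where
  r a b := CuntzLE a b ∧ CuntzLE b a
  iseqv :=
    { refl := fun a => ⟨.refl a, .refl a⟩
      symm := fun h => ⟨h.2, h.1⟩
      trans := fun h₁ h₂ => ⟨h₁.1.trans h₂.1, h₂.2.trans h₁.2⟩ }

variable (A) in
/-- The Cuntz semigroup `W(A)`. -/
def W : Type _ := Quotient (cuntzSetoid (A := A))

/-- The class `⟨a⟩` of a positive element of `Mₙ(A)`. -/
def W.mk {n : ℕ} (a : M n A) (ha : 0 ≤ a) : W A := Quotient.mk _ ⟨n, a, ha⟩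

instance : PartialOrder (W A) where
  le := Quotient.lift₂ CuntzLE fun _ _ _ _ h₁ h₂ => propext
    ⟨fun h => (h₁.2.trans h).trans h₂.1, fun h => (h₁.1.trans h).trans h₂.2⟩
  le_refl := by rintro ⟨a⟩; exact CuntzLE.refl a
  le_trans := by rintro ⟨a⟩ ⟨b⟩ ⟨c⟩ h₁ h₂; exact CuntzLE.trans h₁ h₂
  le_antisymm := by rintro ⟨a⟩ ⟨b⟩ h₁ h₂; exact Quotient.sound ⟨h₁, h₂⟩

/-- The block diagonal matrix `a ⊕ b`. -/
def dsum {n n' m m' : ℕ} (a : CStarMatrix (Fin n) (Fin n') A)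
    (b : CStarMatrix (Fin m) (Fin m') A) : CStarMatrix (Fin (n + m)) (Fin (n' + m')) A :=
  CStarMatrix.ofMatrix ((Matrix.fromBlocks (CStarMatrix.ofMatrix.symm a) 0 0
    (CStarMatrix.ofMatrix.symm b)).submatrix finSumFinEquiv.symm finSumFinEquiv.symm)

lemma dsum_mul {n n' n'' m m' m'' : ℕ} (a : CStarMatrix (Fin n) (Fin n') A)
    (b : CStarMatrix (Fin m) (Fin m') A) (c : CStarMatrix (Fin n') (Fin n'') A)
    (d : CStarMatrix (Fin m') (Fin m'') A) : dsum a b * dsum c d = dsum (a * c) (b * d) := by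
  have key : ∀ (a : Matrix (Fin n) (Fin n') A) (b : Matrix (Fin m) (Fin m') A)
      (c : Matrix (Fin n') (Fin n'') A) (d : Matrix (Fin m') (Fin m'') A),
      (Matrix.fromBlocks a 0 0 b).submatrix finSumFinEquiv.symm finSumFinEquiv.symm *
        (Matrix.fromBlocks c 0 0 d).submatrix finSumFinEquiv.symm finSumFinEquiv.symm =
      (Matrix.fromBlocks (a * c) 0 0 (b * d)).submatrix finSumFinEquiv.symm
        finSumFinEquiv.symm := by
    intro a b c d
    rw [Matrix.submatrix_mul_equiv, Matrix.fromBlocks_multiply]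
    simp
  exact key a b c d

lemma dsum_conjTranspose {n n' m m' : ℕ} (a : CStarMatrix (Fin n) (Fin n') A)
    (b : CStarMatrix (Fin m) (Fin m') A) :
    (dsum a b).conjTranspose = dsum a.conjTranspose b.conjTranspose := by
  have key : ∀ (a : Matrix (Fin n) (Fin n') A) (b : Matrix (Fin m) (Fin m') A),
      ((Matrix.fromBlocks a 0 0 b).submatrix finSumFinEquiv.symm
        finSumFinEquiv.symm).conjTranspose =
      (Matrix.fromBlocks a.conjTranspose 0 0 b.conjTranspose).submatrix finSumFinEquiv.symm
        finSumFinEquiv.symm := by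
    intro a b
    rw [Matrix.conjTranspose_submatrix, Matrix.fromBlocks_conjTranspose]
    simp
  exact key a b

lemma continuous_dsum {n m : ℕ} :
    Continuous fun x : M n A × M m A => dsum x.1 x.2 := by
  have key : Continuous fun x : Matrix (Fin n) (Fin n) A × Matrix (Fin m) (Fin m) A =>
      (Matrix.fromBlocks x.1 0 0 x.2).submatrix finSumFinEquiv.symm finSumFinEquiv.symm :=
    (Continuous.matrix_fromBlocks continuous_fst continuous_const continuous_const
      continuous_snd).matrix_submatrix _ _
  exact key

lemma exists_eq_star_mul_self {B : Type*} [CStarAlgebra B] [PartialOrder B] [StarOrderedRing B]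
    {a : B} (ha : 0 ≤ a) : ∃ x, a = star x * x :=
  CStarAlgebra.nonneg_iff_eq_star_mul_self.mp ha

lemma dsum_nonneg {n m : ℕ} {a : M n A} {b : M m A} (ha : 0 ≤ a) (hb : 0 ≤ b) :
    0 ≤ dsum a b := by
  obtain ⟨x, rfl⟩ := exists_eq_star_mul_self ha
  obtain ⟨y, rfl⟩ := exists_eq_star_mul_self hb
  have h : dsum (star x * x) (star y * y) = star (dsum x y) * dsum x y := by
    simp only [CStarMatrix.star_eq_conjTranspose]
    rw [dsum_conjTranspose]
    exact (dsum_mul _ _ _ _).symm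
  rw [h]
  exact star_mul_self_nonneg _

/-- The direct sum of positive elements. -/
def Pos.add (a b : Pos A) : Pos A := ⟨a.1 + b.1, dsum a.2.1 b.2.1, dsum_nonneg a.2.2 b.2.2⟩

lemma CuntzLE.add {a b c d : Pos A} (h₁ : CuntzLE a b) (h₂ : CuntzLE c d) :
    CuntzLE (a.add c) (b.add d) := by
  rw [cuntzLE_iff] at *
  refine map_mem_closure₂ (f := fun (x : M a.1 A) (y : M c.1 A) => dsum x y)
    continuous_dsum h₁ h₂ ?_
  rintro _ ⟨v, rfl⟩ _ ⟨w, rfl⟩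
  refine ⟨dsum v w, ?_⟩
  change dsum v w * dsum (b.2 : M b.1 A) (d.2 : M d.1 A) * (dsum v w).conjTranspose = _
  rw [dsum_conjTranspose, dsum_mul, dsum_mul]

/-- Addition on `W(A)`: `⟨a⟩ + ⟨b⟩ = ⟨a ⊕ b⟩`. -/
instance : Add (W A) where
  add := Quotient.map₂ Pos.add fun _ _ h₁ _ _ h₂ => ⟨h₁.1.add h₂.1, h₁.2.add h₂.2⟩

variable (A) in
/-- The class of the unit of `A`, viewed as a `1 × 1` matrix. -/
def W.one : W A := W.mk (1 : M 1 A) (zero_le_one' (M 1 A))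

/-! ### Dimension functions -/

variable (A) in
/-- The space `DF(A)` of dimension functions: additive order preserving maps `W(A) → [0, ∞)` which
are normalised at the unit, with the topology of pointwise convergence. -/
abbrev DF : Type _ :=
  {s : W A → ℝ // (∀ x, 0 ≤ s x) ∧ (∀ x y, s (x + y) = s x + s y) ∧ Monotone s ∧
    s (W.one A) = 1}

/-- Quasitraces. -/
structure IsQuasitrace {B : Type*} [CStarAlgebra B] (τ : B → ℂ) : Prop where
  nonneg : ∀ x, 0 ≤ τ (star x * x)
  map_star_mul_self : ∀ x, τ (star x * x) = τ (x * star x)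
  linear_of_commutative : ∀ S : NonUnitalStarSubalgebra ℂ B,
    (∀ x ∈ S, ∀ y ∈ S, x * y = y * x) →
      (∀ x ∈ S, ∀ y ∈ S, τ (x + y) = τ x + τ y) ∧ ∀ (c : ℂ), ∀ x ∈ S, τ (c • x) = c * τ x
  map_add_I_smul : ∀ x y, IsSelfAdjoint x → IsSelfAdjoint y →
    τ (x + Complex.I • y) = τ x + Complex.I * τ y

/-- A function `σ` on `Mₙ(A)` extends `τ` on `A`: `σ (a ⊗ eᵢᵢ) = τ a`. -/
def Extends {n : ℕ} (σ : M n A → ℂ) (τ : A → ℂ) : Prop :=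
  ∀ (i : Fin n) (a : A), σ (CStarMatrix.ofMatrix (Matrix.single i i a)) = τ a

variable (A) in
/-- The normalised 2-quasitraces on `A`. -/
def QT : Set (A → ℂ) :=
  {τ | IsQuasitrace τ ∧ τ 1 = 1 ∧ ∃ σ : M 2 A → ℂ, IsQuasitrace σ ∧ Extends σ τ}

variable (A) in
/-- The set `LDF(A)` of lower semicontinuous dimension functions: those of the form
`d_τ ⟨a⟩ = lim τ (a ^ (1 / k))` for a normalised 2-quasitrace `τ`, where `τ` is evaluated on
`Mₙ(A)` through its extension to a quasitrace there. -/
def LDF : Set (DF A) :=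
  {d | ∃ τ ∈ QT A, ∀ n : ℕ, ∃ σ : M n A → ℂ, IsQuasitrace σ ∧ Extends σ τ ∧
    ∀ (a : M n A) (ha : 0 ≤ a),
      Tendsto (fun k : ℕ => σ (root k a)) atTop (𝓝 ((d.1 (W.mk a ha) : ℝ) : ℂ))}

/-! ### Tracial states -/

variable (A) in
/-- The space `T(A)` of tracial states with the weak-⋆ topology. -/
abbrev TracialState : Type _ :=
  {τ : WeakDual ℂ A // (∀ a, 0 ≤ a → 0 ≤ τ a) ∧ τ 1 = 1 ∧ ∀ a b, τ (a * b) = τ (b * a)}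

/-- The extension of a tracial state to `Mₙ(A)`: `τ(a) = ∑ᵢ τ(aᵢᵢ)`. Its values at self-adjoint
elements are real, and we record the real part. -/
noncomputable def TracialState.tr (τ : TracialState A) {n : ℕ} (a : M n A) : ℝ :=
  (∑ i, τ.1 (a i i)).re

/-- `d_τ(a) = lim τ (a ^ (1 / k))`. -/
noncomputable def TracialState.d (τ : TracialState A) {n : ℕ} (a : M n A) : ℝ :=
  limUnder atTop fun k : ℕ => τ.tr (root k a)

lemma TracialState.tr_rect (τ : TracialState A) {n m : ℕ} (v : CStarMatrix (Fin m) (Fin n) A) :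
    τ.tr (v.conjTranspose * v) = τ.tr (v * v.conjTranspose) := by
  simp only [TracialState.tr, CStarMatrix.mul_apply, CStarMatrix.conjTranspose_apply, map_sum]
  rw [Finset.sum_comm]
  congr 1
  exact Finset.sum_congr rfl fun i _ => Finset.sum_congr rfl fun j _ => τ.2.2.2 _ _

/-! ### Lower semicontinuous affine functions -/

variable (A) in
/-- `LAff_b(T(A))⁺⁺`: the bounded, strictly positive, lower semicontinuous, affine functions on
`T(A)`. -/
structure LAff where
  toFun : TracialState A → ℝ
  lsc : LowerSemicontinuous toFun
  affine : ∀ (σ τ ρ : TracialState A) (t : ℝ), 0 ≤ t → t ≤ 1 →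
    ρ.1 = (t : ℂ) • σ.1 + ((1 - t : ℝ) : ℂ) • τ.1 → toFun ρ = t * toFun σ + (1 - t) * toFun τ
  bounded : ∃ C, ∀ τ, |toFun τ| ≤ C
  pos : ∀ τ, 0 < toFun τ

/-! ### The Murray-von Neumann semigroup -/

variable (A) in
/-- Projections in matrix algebras over `A`. -/
def Proj : Type _ := Σ n : ℕ, {p : M n A // IsStarProjection p}

/-- Murray-von Neumann equivalence `p = v* v`, `q = v v*`. For `p ∈ Mₙ(A)` and `q ∈ Mₘ(A)` such a
`v` in `M_∞(A)` satisfies `v = q v p` and is therefore an `m × n` matrix. -/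
def MvN (p q : Proj A) : Prop :=
  ∃ v : CStarMatrix (Fin q.1) (Fin p.1) A,
    v.conjTranspose * v = (p.2 : M p.1 A) ∧ v * v.conjTranspose = (q.2 : M q.1 A)

instance mvnSetoid : Setoid (Proj A) where
  r := MvN
  iseqv :=
    { refl := fun p => by
        have h : star (p.2 : M p.1 A) = (p.2 : M p.1 A) := p.2.2.isSelfAdjoint
        have h' : (p.2 : M p.1 A) * (p.2 : M p.1 A) = (p.2 : M p.1 A) := p.2.2.isIdempotentElem
        refine ⟨(p.2 : M p.1 A), ?_, ?_⟩
        · change star (p.2 : M p.1 A) * (p.2 : M p.1 A) = _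
          rw [h, h']
        · change (p.2 : M p.1 A) * star (p.2 : M p.1 A) = _
          rw [h, h']
      symm := by
        rintro p q ⟨v, h₁, h₂⟩
        have hv : v.conjTranspose.conjTranspose = v := Matrix.conjTranspose_conjTranspose _
        exact ⟨v.conjTranspose, by rw [hv, h₂], by rw [hv, h₁]⟩
      trans := by
        rintro ⟨n, p, hp⟩ ⟨m, q, hq⟩ ⟨l, r, hr⟩ ⟨v, h₁, h₂⟩ ⟨w, h₃, h₄⟩
        have key : ∀ (v : Matrix (Fin m) (Fin n) A) (w : Matrix (Fin l) (Fin m) A)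
            (p : Matrix (Fin n) (Fin n) A) (q : Matrix (Fin m) (Fin m) A)
            (r : Matrix (Fin l) (Fin l) A), p * p = p → r * r = r →
            v.conjTranspose * v = p → v * v.conjTranspose = q → w.conjTranspose * w = q →
            w * w.conjTranspose = r →
            (w * v).conjTranspose * (w * v) = p ∧ (w * v) * (w * v).conjTranspose = r := by
          intro v w p q r hp hr h₁ h₂ h₃ h₄
          rw [Matrix.conjTranspose_mul]
          constructor
          · calc v.conjTranspose * w.conjTranspose * (w * v)
                = v.conjTranspose * (w.conjTranspose * w) * v := by
                  simp only [Matrix.mul_assoc]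
              _ = (v.conjTranspose * v) * (v.conjTranspose * v) := by
                  rw [h₃, ← h₂]; simp only [Matrix.mul_assoc]
              _ = p := by rw [h₁, hp]
          · calc w * v * (v.conjTranspose * w.conjTranspose)
                = w * (v * v.conjTranspose) * w.conjTranspose := by
                  simp only [Matrix.mul_assoc]
              _ = (w * w.conjTranspose) * (w * w.conjTranspose) := by
                  rw [h₂, ← h₃]; simp only [Matrix.mul_assoc]
              _ = r := by rw [h₄, hr]
        exact ⟨w * v, key v w p q r hp.isIdempotentElem hr.isIdempotentElem h₁ h₂ h₃ h₄⟩ }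

variable (A) in
/-- The semigroup `V(A)` of Murray-von Neumann classes of projections. -/
def V : Type _ := Quotient (mvnSetoid (A := A))

/-- The class of a projection in `V(A)`. -/
def V.mk {n : ℕ} (p : M n A) (hp : IsStarProjection p) : V A := Quotient.mk _ ⟨n, p, hp⟩

/-- The usual order on `V(A)`: `x ≤ y` if `x` and `y` are represented by projections `p ≤ q` in
some `Mₙ(A)`. -/
instance : LE (V A) where
  le x y := ∃ (n : ℕ) (p q : M n A) (hp : IsStarProjection p) (hq : IsStarProjection q),
    x = V.mk p hp ∧ y = V.mk q hq ∧ p ≤ q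

/-- The function `x̂(τ) = τ(x)` on `T(A)` for `x ∈ V(A)`. -/
noncomputable def V.hat (x : V A) (τ : TracialState A) : ℝ :=
  Quotient.lift (fun p : Proj A => τ.tr (p.2 : M p.1 A))
    (by
      rintro p q ⟨v, h₁, h₂⟩
      rw [← h₁, ← h₂]
      exact τ.tr_rect v) x

/-! ### The ordered set `W̃(A)` -/

variable (A) in
/-- `W̃(A)`, the disjoint union of `V(A)` and `LAff_b(T(A))⁺⁺`. -/
inductive WTilde
  | proj (x : V A)
  | aff (f : LAff A)

/-- The order relation of `W̃(A)`. -/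
instance : LE (WTilde A) where
  le
    | .proj x, .proj y => x ≤ y
    | .aff f, .aff g => ∀ τ, f.toFun τ ≤ g.toFun τ
    | .proj x, .aff f => ∀ τ, x.hat τ < f.toFun τ
    | .aff f, .proj x => ∀ τ, f.toFun τ ≤ x.hat τ

/-! ### The canonical map `φ : W(A) → W̃(A)` -/

section Root

variable {B : Type*} [CStarAlgebra B] [PartialOrder B] [StarOrderedRing B]

/-- The root `a ^ (1 / (k + 1))`, normalised to have norm at most one. -/
noncomputable def nroot (k : ℕ) (a : B) : B :=
  ((‖a‖ ^ (-(1 / ((k : ℝ) + 1))) : ℝ) : ℂ) • root (k + 1) a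

lemma root_nonneg (k : ℕ) (a : B) : 0 ≤ root k a := CFC.nnrpow_nonneg

lemma nroot_eq {a : B} (ha : 0 ≤ a) (k : ℕ) : nroot k a =
    cfcₙ (fun x : ℝ => ‖a‖ ^ (-(1 / ((k : ℝ) + 1))) * x ^ (1 / ((k : ℝ) + 1))) a := by
  have hk : (0 : ℝ) < 1 / ((k : ℝ) + 1) := by positivity
  rw [nroot, root, CFC.nnrpow_eq_cfcₙ_real a _ ha, Complex.coe_smul,
    cfcₙ_const_mul _ _ _ (Real.continuous_rpow_const hk.le).continuousOn (Real.zero_rpow hk.ne')]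
  simp

lemma nroot_mono {a : B} (ha : 0 ≤ a) (ha' : a ≠ 0) : Monotone fun k => nroot k a := by
  intro k l hkl
  have hn : 0 < ‖a‖ := norm_pos_iff.2 ha'
  have hk : ∀ k : ℕ, (0 : ℝ) < 1 / ((k : ℝ) + 1) := fun k => by positivity
  have hkl' : 1 / ((l : ℝ) + 1) ≤ 1 / ((k : ℝ) + 1) := by gcongr
  change nroot k a ≤ nroot l a
  rw [nroot_eq ha, nroot_eq ha]
  refine cfcₙ_mono ?_ ?_ ?_ ?_ ?_
  · intro x hx
    have hx0 : 0 ≤ x := quasispectrum_nonneg_of_nonneg a ha x hx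
    have hxn : x ≤ ‖a‖ := by
      exact (le_abs_self x).trans
        (NonUnitalIsometricContinuousFunctionalCalculus.norm_quasispectrum_le a hx
          (IsSelfAdjoint.of_nonneg ha))
    have e : ∀ k : ℕ, ‖a‖ ^ (-(1 / ((k : ℝ) + 1))) * x ^ (1 / ((k : ℝ) + 1)) =
        (x / ‖a‖) ^ (1 / ((k : ℝ) + 1)) := fun k => by
      rw [Real.div_rpow hx0 hn.le, Real.rpow_neg hn.le, mul_comm]
      rfl
    rw [e, e]
    rcases hx0.eq_or_lt with rfl | hx0
    · rw [zero_div, Real.zero_rpow (hk _).ne', Real.zero_rpow (hk _).ne']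
    · exact Real.rpow_le_rpow_of_exponent_ge (by positivity) ((div_le_one hn).2 hxn) hkl'
  · exact (continuous_const.mul (Real.continuous_rpow_const (hk k).le)).continuousOn
  · exact (continuous_const.mul (Real.continuous_rpow_const (hk l).le)).continuousOn
  · rw [Real.zero_rpow (hk _).ne', mul_zero]
  · rw [Real.zero_rpow (hk _).ne', mul_zero]

lemma nroot_nonneg {a : B} (k : ℕ) : 0 ≤ nroot k a := by
  rw [nroot, Complex.coe_smul]
  exact smul_nonneg (by positivity) (root_nonneg _ _)

lemma nroot_le_one {a : B} (ha : 0 ≤ a) (ha' : a ≠ 0) (k : ℕ) : nroot k a ≤ 1 := by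
  have hn : 0 < ‖a‖ := norm_pos_iff.2 ha'
  refine (CStarAlgebra.norm_le_one_iff_of_nonneg _ (nroot_nonneg k)).1 ?_
  rw [nroot, norm_smul, root, CFC.norm_nnrpow _ (by positivity) ha, Complex.norm_real,
    Real.norm_of_nonneg (by positivity), ← Real.rpow_add hn]
  simp

lemma nroot_zero {a : B} (ha : 0 ≤ a) : nroot 0 a = ((‖a‖⁻¹ : ℝ) : ℂ) • a := by
  rw [nroot, root]
  simp [CFC.nnrpow_one a ha, Real.rpow_neg_one]

end Root

namespace TracialState

variable (τ : TracialState A)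

lemma tr_add {n : ℕ} (a b : M n A) : τ.tr (a + b) = τ.tr a + τ.tr b := by
  simp [tr, Finset.sum_add_distrib]

lemma tr_smul {n : ℕ} (r : ℝ) (a : M n A) : τ.tr ((r : ℂ) • a) = r * τ.tr a := by
  have h : ∀ i, τ.1 (((r : ℂ) • a) i i) = (r : ℂ) * τ.1 (a i i) := fun i => by
    rw [CStarMatrix.smul_apply, map_smul, smul_eq_mul]
  simp only [tr, h, ← Finset.mul_sum, Complex.re_ofReal_mul]

lemma tr_star_mul_self {n : ℕ} (x : M n A) :
    τ.tr (star x * x) = ∑ i, ∑ j, (τ.1 (star (x j i) * x j i)).re := by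
  simp [tr, CStarMatrix.mul_apply, CStarMatrix.star_apply]

lemma apply_star_mul_self_nonneg (x : A) : 0 ≤ (τ.1 (star x * x)).re :=
  (Complex.nonneg_iff.1 (τ.2.1 _ (star_mul_self_nonneg x))).1

lemma tr_nonneg {n : ℕ} {a : M n A} (ha : 0 ≤ a) : 0 ≤ τ.tr a := by
  obtain ⟨x, rfl⟩ := exists_eq_star_mul_self ha
  rw [tr_star_mul_self]
  exact Finset.sum_nonneg fun i _ => Finset.sum_nonneg fun j _ => τ.apply_star_mul_self_nonneg _

lemma tr_mono {n : ℕ} {a b : M n A} (h : a ≤ b) : τ.tr a ≤ τ.tr b := by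
  have := τ.tr_nonneg (sub_nonneg.2 h)
  have h' := τ.tr_add (b - a) a
  rw [sub_add_cancel] at h'
  linarith

lemma tr_one {n : ℕ} : τ.tr (1 : M n A) = n := by
  simp [tr, τ.2.2.1]

lemma continuous_tr {n : ℕ} (a : M n A) : Continuous fun τ : TracialState A => τ.tr a := by
  unfold tr
  refine Complex.continuous_re.comp (continuous_finsetSum _ fun i _ => ?_)
  exact (WeakDual.eval_continuous (a i i)).comp continuous_subtype_val

lemma re_mono {a b : A} (h : a ≤ b) : (τ.1 a).re ≤ (τ.1 b).re := by
  have := (Complex.nonneg_iff.1 (τ.2.1 _ (sub_nonneg.2 h))).1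
  rw [map_sub, Complex.sub_re] at this
  linarith

/-- The closed two-sided ideal of elements `x` with `τ (x* x) = 0`. -/
def ker : TwoSidedIdeal A :=
  have hl : ∀ a x : A, (τ.1 (star x * x)).re = 0 → (τ.1 (star (a * x) * (a * x))).re = 0 := by
    intro a x hx
    refine le_antisymm ?_ (τ.apply_star_mul_self_nonneg _)
    have h1 : star (a * x) * (a * x) ≤ ((‖star a * a‖ : ℝ) : ℂ) • (star x * x) := by
      have := CStarAlgebra.star_left_conjugate_le_norm_smul (a := x) (b := star a * a)
        (IsSelfAdjoint.star_mul_self a)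
      rw [Complex.coe_smul]
      simpa [mul_assoc] using this
    have h2 := τ.re_mono h1
    rw [map_smul, smul_eq_mul, Complex.re_ofReal_mul, hx, mul_zero] at h2
    exact h2
  have hs : ∀ x : A, (τ.1 (star x * x)).re = 0 → (τ.1 (star (star x) * star x)).re = 0 := by
    intro x hx
    rw [star_star, τ.2.2.2, hx]
  TwoSidedIdeal.mk' {x | (τ.1 (star x * x)).re = 0} (by simp)
    (by
      intro x y hx hy
      refine le_antisymm ?_ (τ.apply_star_mul_self_nonneg _)
      have h := τ.apply_star_mul_self_nonneg (x - y)
      have e : star (x + y) * (x + y) + star (x - y) * (x - y) =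
          (star x * x + star x * x) + (star y * y + star y * y) := by
        simp only [star_add, star_sub]
        noncomm_ring
      have e' := congrArg (fun z => (τ.1 z).re) e
      simp only [map_add, Complex.add_re] at e'
      simp only [Set.mem_ofPred_eq] at hx hy
      linarith)
    (by intro x hx; simpa using hx)
    (by intro x y hy; exact hl x y hy)
    (by
      intro x y hx
      have := hs _ (hl (star y) (star x) (hs x hx))
      simpa using this)

lemma eq_zero_of_apply_star_mul_self [IsSimple A] {x : A} (hx : (τ.1 (star x * x)).re = 0) :
    x = 0 := by
  have hmem : ∀ y, y ∈ τ.ker ↔ (τ.1 (star y * y)).re = 0 := fun y => by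
    unfold ker
    exact TwoSidedIdeal.mem_mk' ..
  have hcl : IsClosed (τ.ker : Set A) := by
    have : (τ.ker : Set A) = {y | (τ.1 (star y * y)).re = 0} := Set.ext hmem
    rw [this]
    refine isClosed_eq ?_ continuous_const
    exact Complex.continuous_re.comp
      ((show Continuous fun z : A => τ.1 z from (WeakDual.toStrongDual τ.1).continuous).comp
        (continuous_star.mul continuous_id))
  rcases IsSimple.eq_bot_or_eq_top τ.ker hcl with h | h
  · have := (hmem x).2 hx
    rw [h] at this
    simpa using this
  · have : (1 : A) ∈ τ.ker := by rw [h]; trivial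
    rw [hmem] at this
    simp [τ.2.2.1] at this

lemma tr_pos [IsSimple A] {n : ℕ} {a : M n A} (ha : 0 ≤ a) (ha' : a ≠ 0) : 0 < τ.tr a := by
  refine lt_of_le_of_ne (τ.tr_nonneg ha) fun h => ha' ?_
  obtain ⟨x, rfl⟩ := exists_eq_star_mul_self ha
  rw [tr_star_mul_self] at h
  have hx : x = 0 := by
    ext i j
    refine τ.eq_zero_of_apply_star_mul_self ?_
    have h1 := (Finset.sum_eq_zero_iff_of_nonneg fun i _ => Finset.sum_nonneg fun j _ =>
      τ.apply_star_mul_self_nonneg _).1 h.symm j (Finset.mem_univ _)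
    exact (Finset.sum_eq_zero_iff_of_nonneg fun j _ =>
      τ.apply_star_mul_self_nonneg _).1 h1 i (Finset.mem_univ _)
  rw [hx, mul_zero]

lemma bddAbove_nroot {n : ℕ} {a : M n A} (ha : 0 ≤ a) (ha' : a ≠ 0) :
    BddAbove (Set.range fun k => τ.tr (nroot k a)) :=
  ⟨n, by
    rintro _ ⟨k, rfl⟩
    exact (τ.tr_mono (nroot_le_one ha ha' k)).trans τ.tr_one.le⟩

lemma tendsto_tr_root {n : ℕ} {a : M n A} (ha : 0 ≤ a) (ha' : a ≠ 0) :
    Tendsto (fun k : ℕ => τ.tr (root k a)) atTop (𝓝 (⨆ k, τ.tr (nroot k a))) := by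
  have hn : 0 < ‖a‖ := norm_pos_iff.2 ha'
  have h1 := tendsto_atTop_ciSup
    (fun k l hkl => τ.tr_mono (nroot_mono ha ha' hkl) : Monotone fun k => τ.tr (nroot k a))
    (τ.bddAbove_nroot ha ha')
  have h2 : Tendsto (fun k : ℕ => ‖a‖ ^ (1 / ((k : ℝ) + 1))) atTop (𝓝 1) := by
    have := tendsto_one_div_add_atTop_nhds_zero_nat (𝕜 := ℝ)
    simpa using (tendsto_const_nhds (x := ‖a‖)).rpow this (Or.inl hn.ne')
  rw [← tendsto_add_atTop_iff_nat 1]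
  have h3 := h2.mul h1
  rw [one_mul] at h3
  refine h3.congr fun k => ?_
  rw [nroot, tr_smul, ← mul_assoc, ← Real.rpow_add hn]
  simp

lemma d_eq {n : ℕ} {a : M n A} (ha : 0 ≤ a) (ha' : a ≠ 0) :
    τ.d a = ⨆ k, τ.tr (nroot k a) :=
  (τ.tendsto_tr_root ha ha').limUnder_eq

end TracialState

/-- The element `τ ↦ d_τ(a)` of `LAff_b(T(A))⁺⁺` for a nonzero positive element `a`. -/
noncomputable def dimAff [IsSimple A] {n : ℕ} (a : M n A) (ha : 0 ≤ a) (ha' : a ≠ 0) : LAff A where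
  toFun τ := τ.d a
  lsc := by
    have h : (fun τ : TracialState A => τ.d a) = fun τ => ⨆ k, τ.tr (nroot k a) :=
      funext fun τ => τ.d_eq ha ha'
    rw [h]
    exact lowerSemicontinuous_ciSup (fun τ => τ.bddAbove_nroot ha ha')
      fun k => (TracialState.continuous_tr _).lowerSemicontinuous
  affine := by
    intro σ τ ρ t _ _ h
    rw [σ.d_eq ha ha', τ.d_eq ha ha', ρ.d_eq ha ha']
    refine tendsto_nhds_unique (ρ.tendsto_tr_root ha ha') ?_
    refine (((σ.tendsto_tr_root ha ha').const_mul t).add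
      ((τ.tendsto_tr_root ha ha').const_mul (1 - t))).congr fun k => ?_
    have h' : ∀ x, ρ.1 x = (t : ℂ) * σ.1 x + ((1 - t : ℝ) : ℂ) * τ.1 x := by
      intro x
      rw [h]
      rfl
    simp only [TracialState.tr, h', Finset.sum_add_distrib, ← Finset.mul_sum, Complex.add_re,
      Complex.re_ofReal_mul]
  bounded := by
    refine ⟨n, fun τ => ?_⟩
    rw [τ.d_eq ha ha', abs_of_nonneg]
    · exact ciSup_le fun k => (τ.tr_mono (nroot_le_one ha ha' k)).trans τ.tr_one.le
    · exact Real.iSup_nonneg fun k => τ.tr_nonneg (nroot_nonneg k)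
  pos := by
    intro τ
    rw [τ.d_eq ha ha']
    refine lt_of_lt_of_le ?_ (le_ciSup (τ.bddAbove_nroot ha ha') 0)
    rw [nroot_zero ha, τ.tr_smul]
    exact mul_pos (inv_pos.2 (norm_pos_iff.2 ha')) (τ.tr_pos ha ha')

/-- The natural map from projections to `W(A)`. -/
def Proj.toW (p : Proj A) : W A := W.mk (p.2 : M p.1 A) p.2.2.nonneg

/-- `x ∈ W(A)₊`: the class `x` is purely positive, that is, not the class of a projection. -/
def W.PurelyPositive (x : W A) : Prop := ¬ ∃ p : Proj A, p.toW = x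

lemma W.PurelyPositive.out_ne_zero {x : W A} (hx : x.PurelyPositive) :
    (x.out.2 : M x.out.1 A) ≠ 0 := by
  intro h
  refine hx ⟨⟨x.out.1, 0, IsStarProjection.zero _⟩, ?_⟩
  conv_rhs => rw [← x.out_eq]
  refine congrArg (Quotient.mk _) ?_
  refine Sigma.ext rfl (heq_of_eq (Subtype.ext h.symm))

/-- The map `ι : W(A)₊ → LAff_b(T(A))⁺⁺`, `ι(⟨a⟩)(τ) = d_τ(a)`. The function `d_τ` is constant on
Cuntz equivalence classes, so that any representative may be used. -/
noncomputable def iota [IsSimple A] (x : W A) (hx : x.PurelyPositive) : LAff A :=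
  dimAff (x.out.2 : M x.out.1 A) x.out.2.2 hx.out_ne_zero

open Classical in
/-- The canonical map `φ : W(A) → W̃(A)`: it sends the class of a projection `p` in `W(A)` to the
class of `p` in `V(A)`, and it is `ι` on purely positive classes. When `A` is stably finite, Cuntz
equivalent projections are Murray-von Neumann equivalent, so that the choice of `p` is
irrelevant. -/
noncomputable def phi [IsSimple A] (x : W A) : WTilde A :=
  if h : ∃ p : Proj A, p.toW = x then .proj (Quotient.mk _ h.choose) else .aff (iota x h)

end Cuntz

namespace Cuntz

open Filter Topology
open scoped ComplexOrder NNReal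

set_option linter.unusedSectionVars false

variable {A : Type*} [CStarAlgebra A] [PartialOrder A] [StarOrderedRing A]

/-! ### Rectangular matrices -/

/-! The functions `d_τ` of tracial states form a convex subset of `DF(A)`. If a dimension function
`s` lies outside its closure, finitely many coordinates witness this and Hahn–Banach separates them
by a linear functional. Scaling the functional and rounding its coefficients to integers gives two
classes with `s(x) < s(y)` but `d_τ(y) + 1 ≤ d_τ(x)` for all `τ` (`exists_separating`).

It would now be enough to know `y ≤ x`. Traces need not decide the order of `W̃(A)` between two
projection classes, whereas an affine element lies below everything that dominates it on `T(A)`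
(`le_of_forall_toDF_le`). So `y` is enlarged by the class of a positive `z` in `M₁(A)` whose
spectrum accumulates at zero. Simplicity makes `s` faithful (`DF.pos`), which forces `y + ⟨z⟩` to be
purely positive (`purelyPositive_add`), and the margin 1 absorbs `d_τ(z) ≤ 1`. Hence `y + ⟨z⟩ ≤ x`,
and `s(y) ≤ s(x)`, a contradiction.

If there is no such `z`, every left ideal of `M₁(A)` is generated by a projection, so the algebra is
semisimple and, being simple, a full matrix algebra over `ℂ` (`exists_algEquiv_matrix`). Comparison
of ranks then decides Cuntz comparison, so there is only one dimension function, namely that of the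
normalised trace (`DF.eq_of_algEquiv_matrix`). -/

lemma rect_mul_assoc {k l m n : ℕ} (x : CStarMatrix (Fin k) (Fin l) A)
    (y : CStarMatrix (Fin l) (Fin m) A) (z : CStarMatrix (Fin m) (Fin n) A) :
    x * y * z = x * (y * z) :=
  Matrix.mul_assoc _ _ _

lemma rect_conjTranspose_mul {k l m : ℕ} (x : CStarMatrix (Fin k) (Fin l) A)
    (y : CStarMatrix (Fin l) (Fin m) A) :
    (x * y).conjTranspose = y.conjTranspose * x.conjTranspose :=
  Matrix.conjTranspose_mul _ _

lemma rect_conjTranspose_conjTranspose {k l : ℕ} (x : CStarMatrix (Fin k) (Fin l) A) :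
    x.conjTranspose.conjTranspose = x :=
  Matrix.conjTranspose_conjTranspose _

/-- Placing each row of `y` as the first row of an otherwise zero square matrix turns the product
into a sum of squares in `Mₙ(A)`. The size `n = 0` is separate because it has no first row. -/
lemma conjTranspose_mul_self_nonneg {m n : ℕ} (y : CStarMatrix (Fin m) (Fin n) A) :
    (0 : M n A) ≤ y.conjTranspose * y := by
  rcases n with _ | n
  · exact le_of_eq (by ext i; exact i.elim0)
  let Y : Fin m → M (n + 1) A := fun i =>
    CStarMatrix.ofMatrix fun k l => if k = 0 then y i l else 0
  have hY : ∀ i k l, Y i k l = if k = 0 then y i l else 0 := fun _ _ _ => rfl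
  have h : (y.conjTranspose * y : M (n + 1) A) = ∑ i, star (Y i) * Y i := by
    have key : ∀ k l, (∑ i, star (Y i) * Y i) k l = ∑ i, (star (Y i) * Y i) k l := by
      intro k l
      exact Matrix.sum_apply k l _ _
    ext k l
    rw [key, CStarMatrix.mul_apply]
    refine Finset.sum_congr rfl fun i _ => ?_
    rw [CStarMatrix.mul_apply, Finset.sum_eq_single 0]
    · rw [CStarMatrix.star_apply, hY, hY, if_pos rfl, if_pos rfl, CStarMatrix.conjTranspose_apply]
    · intro j _ hj
      rw [hY i j, if_neg hj, mul_zero]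
    · simp
  rw [h]
  exact Finset.sum_nonneg fun i _ => star_mul_self_nonneg _

lemma mul_mul_conjTranspose_eq {m n : ℕ} (v : CStarMatrix (Fin n) (Fin m) A) (x : M m A) :
    (v * (star x * x) * v.conjTranspose : M n A) =
      (x * v.conjTranspose).conjTranspose * (x * v.conjTranspose) := by
  rw [rect_conjTranspose_mul, rect_conjTranspose_conjTranspose]
  change v * (x.conjTranspose * x) * v.conjTranspose = _
  simp only [rect_mul_assoc]

lemma conj_nonneg {m n : ℕ} (v : CStarMatrix (Fin n) (Fin m) A) {b : M m A} (hb : 0 ≤ b) :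
    (0 : M n A) ≤ v * b * v.conjTranspose := by
  obtain ⟨x, rfl⟩ := exists_eq_star_mul_self hb
  rw [mul_mul_conjTranspose_eq]
  exact conjTranspose_mul_self_nonneg _

/-! ### Cuntz subequivalence -/

/-- If `0 ≤ a ≤ b` then `a` is a limit of elements `v b v*`. -/
lemma exists_norm_conj_sub_le {B : Type*} [CStarAlgebra B] [PartialOrder B] [StarOrderedRing B]
    {a b : B} (ha : 0 ≤ a) (hab : a ≤ b) {ε : ℝ} (hε : 0 < ε) :
    ∃ v : B, ‖v * b * star v - a‖ ≤ ε := by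
  have hb : 0 ≤ b := ha.trans hab
  have hε1 : IsStrictlyPositive (algebraMap ℝ B ε) :=
    IsStrictlyPositive.iff_of_unital.2 ⟨algebraMap_nonneg _ hε.le,
      (IsUnit.mk0 ε hε.ne').map (algebraMap ℝ B)⟩
  have hu : IsStrictlyPositive (algebraMap ℝ B ε + b) := hε1.add_nonneg hb
  set u := algebraMap ℝ B ε + b with hu_def
  set w := u ^ (-(1 / 2) : ℝ) with hw_def
  have hw : star w = w := (IsSelfAdjoint.of_nonneg CFC.rpow_nonneg).star_eq
  have h1 : w * u * w = 1 := CFC.conjugate_rpow_neg_one_half u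
  set h := CFC.sqrt a
  have hh : star h = h := (IsSelfAdjoint.of_nonneg (CFC.sqrt_nonneg a)).star_eq
  have hha : h * h = a := CFC.sqrt_mul_sqrt_self a
  have h2 : w * b * w = 1 - ε • (w * w) := by
    rw [← h1, hu_def, mul_add, add_mul, Algebra.algebraMap_eq_smul_one]
    simp
  -- For `v = a^(1/2) (ε + b)^(-1/2)` the error is exactly `-ε v v*`, and `‖v v*‖ = ‖v* v‖ ≤ 1`
  -- because `a ≤ ε + b`.
  refine ⟨h * w, ?_⟩
  have h3 : h * w * b * star (h * w) - a = -(ε • ((h * w) * star (h * w))) := by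
    calc h * w * b * star (h * w) - a = h * (w * b * w) * h - h * h := by
          rw [star_mul, hw, hh, hha]; noncomm_ring
      _ = _ := by
          rw [h2, star_mul, hw, hh, mul_sub, sub_mul]
          simp [mul_assoc]
  have h4 : star (h * w) * (h * w) = w * a * w := by
    rw [star_mul, hw, hh, ← hha]; noncomm_ring
  have h5 : w * a * w ≤ 1 := by
    rw [← h1]
    have h6 : a ≤ u := hab.trans (le_add_of_nonneg_left hε1.nonneg)
    have := star_left_conjugate_le_conjugate h6 w
    rwa [hw] at this
  have h7 : ‖w * a * w‖ ≤ 1 := by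
    refine (CStarAlgebra.norm_le_one_iff_of_nonneg _ ?_).2 h5
    rw [← h4]
    exact star_mul_self_nonneg _
  rw [h3, norm_neg, norm_smul, CStarRing.norm_self_mul_star, ← CStarRing.norm_star_mul_self, h4,
    Real.norm_of_nonneg hε.le]
  exact mul_le_of_le_one_right hε.le h7

lemma mk_le_mk_iff {n m : ℕ} {a : M n A} {ha : 0 ≤ a} {b : M m A} {hb : 0 ≤ b} :
    W.mk a ha ≤ W.mk b hb ↔ a ∈ closure
      (Set.range fun v : CStarMatrix (Fin n) (Fin m) A => (v * b * v.conjTranspose : M n A)) :=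
  cuntzLE_iff ⟨n, a, ha⟩ ⟨m, b, hb⟩

lemma mk_add_mk {n m : ℕ} {a : M n A} (ha : 0 ≤ a) {b : M m A} (hb : 0 ≤ b) :
    W.mk a ha + W.mk b hb = W.mk (dsum a b) (dsum_nonneg ha hb) :=
  rfl

lemma W.ind {motive : W A → Prop} (h : ∀ (n : ℕ) (a : M n A) (ha : 0 ≤ a), motive (W.mk a ha))
    (x : W A) : motive x := by
  induction x using Quotient.inductionOn with
  | h a => exact h a.1 a.2.1 a.2.2

lemma mk_conj_le {n m : ℕ} {a : M n A} (ha : 0 ≤ a) {b : M m A} (hb : 0 ≤ b)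
    (v : CStarMatrix (Fin n) (Fin m) A) (h : (v * b * v.conjTranspose : M n A) = a) :
    W.mk a ha ≤ W.mk b hb :=
  mk_le_mk_iff.2 (subset_closure ⟨v, h⟩)

lemma mk_mono {n : ℕ} {a b : M n A} (ha : 0 ≤ a) (hb : 0 ≤ b) (hab : a ≤ b) :
    W.mk a ha ≤ W.mk b hb := by
  rw [mk_le_mk_iff, Metric.mem_closure_iff]
  intro ε hε
  obtain ⟨v, hv⟩ := exists_norm_conj_sub_le ha hab (half_pos hε)
  refine ⟨_, ⟨v, rfl⟩, ?_⟩
  rw [dist_comm, dist_eq_norm]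
  exact hv.trans_lt (half_lt_self hε)

lemma mk_smul_le {n : ℕ} {a : M n A} (ha : 0 ≤ a) {r : ℝ} (hr : 0 ≤ r)
    (hra : 0 ≤ r • a) : W.mk (r • a) hra ≤ W.mk a ha := by
  refine mk_conj_le _ _ (((√r : ℝ) : ℂ) • (1 : M n A)) ?_
  change ((√r : ℝ) : ℂ) • (1 : M n A) * a * star (((√r : ℝ) : ℂ) • (1 : M n A)) = r • a
  rw [star_smul, star_one, smul_mul_assoc, one_mul, mul_smul_comm, mul_one, smul_smul,
    RCLike.star_def, Complex.conj_ofReal, ← Complex.ofReal_mul, Real.mul_self_sqrt hr,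
    Complex.coe_smul]
  rfl

lemma mk_le_of_le_smul {n : ℕ} {a b : M n A} (ha : 0 ≤ a) (hb : 0 ≤ b) {r : ℝ} (hr : 0 ≤ r)
    (h : a ≤ r • b) : W.mk a ha ≤ W.mk b hb :=
  (mk_mono ha (smul_nonneg hr hb) h).trans (mk_smul_le hb hr _)

lemma le_norm_smul_one {B : Type*} [CStarAlgebra B] [PartialOrder B] [StarOrderedRing B]
    {a : B} (ha : 0 ≤ a) : a ≤ ‖a‖ • (1 : B) := by
  rw [← Algebra.algebraMap_eq_smul_one]
  exact (IsSelfAdjoint.of_nonneg ha).le_algebraMap_norm_self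

lemma mk_le_mk_one {n : ℕ} {a : M n A} (ha : 0 ≤ a) :
    W.mk a ha ≤ W.mk (1 : M n A) zero_le_one :=
  mk_le_of_le_smul ha zero_le_one (norm_nonneg a) (le_norm_smul_one ha)

lemma dsum_one_one {n m : ℕ} : dsum (1 : M n A) (1 : M m A) = 1 := by
  have key : (Matrix.fromBlocks (1 : Matrix (Fin n) (Fin n) A) 0 0
      (1 : Matrix (Fin m) (Fin m) A)).submatrix finSumFinEquiv.symm finSumFinEquiv.symm = 1 := by
    rw [Matrix.fromBlocks_one, Matrix.submatrix_one_equiv]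
  exact key

/-! ### Bounds for dimension functions -/

namespace DF

variable (s : DF A)

lemma nonneg (x : W A) : 0 ≤ s.1 x := s.2.1 x

lemma map_add (x y : W A) : s.1 (x + y) = s.1 x + s.1 y := s.2.2.1 x y

lemma mono {x y : W A} (h : x ≤ y) : s.1 x ≤ s.1 y := s.2.2.2.1 h

lemma map_one : s.1 (W.one A) = 1 := s.2.2.2.2

/-- The crude bound `n + 1` starts the induction at `n = 0` without the value of `s` at the zero
class. -/
lemma mk_one_le (n : ℕ) : s.1 (W.mk (1 : M n A) zero_le_one) ≤ n + 1 := by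
  induction n with
  | zero =>
    have h : W.mk (1 : M 0 A) zero_le_one ≤ W.one A :=
      mk_conj_le _ _ (0 : CStarMatrix (Fin 0) (Fin 1) A) (by ext i; exact i.elim0)
    simpa using (s.mono h).trans s.map_one.le
  | succ n ih =>
    have h : W.mk (1 : M (n + 1) A) zero_le_one = W.mk (1 : M n A) zero_le_one + W.one A := by
      rw [W.one, mk_add_mk]
      congr 1
      exact dsum_one_one.symm
    rw [h, s.map_add, s.map_one]
    push_cast
    linarith

end DF

/-- The bound is uniform in `s`; it controls the rounding error in `exists_separating`. -/
lemma exists_forall_apply_le (x : W A) : ∃ C : ℝ, ∀ s : DF A, s.1 x ≤ C := by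
  induction x using W.ind with
  | h n a ha => exact ⟨n + 1, fun s => (s.mono (mk_le_mk_one ha)).trans (s.mk_one_le n)⟩

/-! ### Roots -/

section Roots

variable {B : Type*} [CStarAlgebra B] [PartialOrder B] [StarOrderedRing B]

lemma pow_nonneg_of_nonneg {a : B} (ha : 0 ≤ a) (k : ℕ) : 0 ≤ a ^ k := by
  rw [← CFC.rpow_natCast a k ha]
  exact CFC.rpow_nonneg

/-- Positive roots are unique, so the roots of projections, scalar multiples and direct sums are
found by taking powers. -/
lemma root_eq_of_pow_eq {k : ℕ} {a b : B} (hb : 0 ≤ b) (h : b ^ (k + 1) = a) :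
    root (k + 1) a = b := by
  have ha : 0 ≤ a := h ▸ pow_nonneg_of_nonneg hb _
  have hk : ((k + 1 : ℕ) : ℝ≥0) ≠ 0 := by positivity
  rw [root, one_div, CFC.nnrpow_inv_eq a b hk ha hb, CFC.nnrpow_eq_rpow (pos_iff_ne_zero.2 hk), ← h]
  exact CFC.rpow_natCast b (k + 1) hb

lemma root_pow {k : ℕ} {a : B} (ha : 0 ≤ a) : root (k + 1) a ^ (k + 1) = a := by
  have hk : ((k + 1 : ℕ) : ℝ≥0) ≠ 0 := by positivity
  rw [← CFC.rpow_natCast _ _ (root_nonneg _ _), ← NNReal.coe_natCast,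
    ← CFC.nnrpow_eq_rpow (pos_iff_ne_zero.2 hk), root, one_div]
  exact CFC.nnrpow_inv_nnrpow a hk ha

lemma root_of_isStarProjection (k : ℕ) {p : B} (hp : IsStarProjection p) :
    root (k + 1) p = p :=
  root_eq_of_pow_eq hp.nonneg (hp.pow_succ_eq k)

lemma root_zero_right (k : ℕ) : root k (0 : B) = 0 := CFC.zero_nnrpow

lemma root_smul (k : ℕ) {a : B} (ha : 0 ≤ a) {r : ℝ} (hr : 0 ≤ r) :
    root (k + 1) ((r : ℂ) • a) = ((r ^ (1 / ((k : ℝ) + 1)) : ℝ) : ℂ) • root (k + 1) a := by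
  refine root_eq_of_pow_eq ?_ ?_
  · rw [Complex.coe_smul]
    exact smul_nonneg (by positivity) (root_nonneg _ _)
  · rw [smul_pow, root_pow ha, ← Complex.ofReal_pow, ← Real.rpow_natCast, ← Real.rpow_mul hr]
    congr
    push_cast
    rw [one_div, inv_mul_cancel₀ (by positivity), Real.rpow_one]

/-- Löwner–Heinz: exponents in `(0, 1]` give operator monotone functions. -/
lemma root_mono (k : ℕ) {a b : B} (hab : a ≤ b) : root (k + 1) a ≤ root (k + 1) b := by
  refine CFC.nnrpow_le_nnrpow ⟨zero_le, ?_⟩ hab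
  rw [one_div]
  exact inv_le_one_of_one_le₀ (by simp)

lemma root_eq_cfcₙ (k : ℕ) {a : B} (ha : 0 ≤ a) :
    root (k + 1) a = cfcₙ (fun x : ℝ => x ^ (1 / ((k : ℝ) + 1))) a := by
  rw [root, CFC.nnrpow_eq_cfcₙ_real a _ ha]
  simp

lemma tendsto_root (k : ℕ) {a : B} (ha : 0 ≤ a) {x : ℕ → B} (hx : ∀ j, 0 ≤ x j)
    (h : Tendsto x atTop (𝓝 a)) :
    Tendsto (fun j => root k (x j)) atTop (𝓝 (root k a)) :=
  ((CFC.continuousOn_nnrpow _) a ha).tendsto.comp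
    (tendsto_nhdsWithin_iff.2 ⟨h, Eventually.of_forall hx⟩)

lemma exists_star_eq_mul_self {b : B} (hb : 0 ≤ b) : ∃ h : B, star h = h ∧ star h * h = b := by
  have h := (IsSelfAdjoint.of_nonneg (CFC.sqrt_nonneg b)).star_eq
  exact ⟨CFC.sqrt b, h, by rw [h]; exact CFC.sqrt_mul_sqrt_self b⟩

/-- The summand 1 keeps the constant nonzero even for `g = 0`, so that its roots tend to 1. -/
lemma star_mul_mul_le {g : B} (hg : 0 ≤ g) (h : B) :
    star h * g * h ≤ ((‖g‖ + 1 : ℝ) : ℂ) • (star h * h) := by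
  rw [Complex.coe_smul]
  refine (CStarAlgebra.star_left_conjugate_le_norm_smul (IsSelfAdjoint.of_nonneg hg)).trans ?_
  exact smul_le_smul_of_nonneg_right (by linarith) (star_mul_self_nonneg h)

end Roots

/-- Polynomials without constant term which approximate a continuous function vanishing at zero in
the functional calculus of every positive element of norm at most `R`. -/
lemma exists_polynomial_tendsto_cfcₙ.{u} {f : ℝ → ℝ} (hf : Continuous f) (hf0 : f 0 = 0) (R : ℝ) :
    ∃ (N : ℕ → ℕ) (c : ℕ → ℕ → ℝ), ∀ (B : Type u) [CStarAlgebra B] [PartialOrder B]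
      [StarOrderedRing B] (a : B), 0 ≤ a → ‖a‖ ≤ R →
      Tendsto (fun j => ∑ i ∈ Finset.range (N j), (c j i : ℂ) • a ^ (i + 1)) atTop
        (𝓝 (cfcₙ f a)) := by
  have h : ∀ j : ℕ, ∃ p : Polynomial ℝ, ∀ x ∈ Set.Icc 0 R, |p.eval x - f x| < 1 / ((j : ℝ) + 1) :=
    fun j => exists_polynomial_near_of_continuousOn 0 R f hf.continuousOn _ (by positivity)
  choose p hp using h
  refine ⟨fun j => (p j).natDegree, fun j i => (p j).coeff (i + 1), fun B _ _ _ a ha haR => ?_⟩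
  have hR : 0 ≤ R := (norm_nonneg a).trans haR
  -- Dropping the constant term replaces `p` by `p - p(0)`. Since `f 0 = 0`, this at most doubles
  -- the error.
  have hsum : ∀ j, ∑ i ∈ Finset.range (p j).natDegree,
      (((p j).coeff (i + 1) : ℝ) : ℂ) • a ^ (i + 1) = cfc (fun x => (p j).eval x - (p j).eval 0) a := by
    intro j
    have e : (fun x : ℝ => (p j).eval x - (p j).eval 0) =
        ∑ i ∈ Finset.range (p j).natDegree, fun x => (p j).coeff (i + 1) * x ^ (i + 1) := by
      funext x
      rw [Finset.sum_apply, Polynomial.eval_eq_sum_range, Finset.sum_range_succ',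
        ← Polynomial.coeff_zero_eq_eval_zero]
      simp
    rw [e, cfc_sum _ a _ (fun i _ => by fun_prop)]
    refine Finset.sum_congr rfl fun i _ => ?_
    rw [cfc_const_mul _ _ _ (by fun_prop), cfc_pow_id a _, Complex.coe_smul]
  have h2 : Tendsto (fun j : ℕ => 2 * (1 / ((j : ℝ) + 1))) atTop (𝓝 0) := by
    simpa using (tendsto_one_div_add_atTop_nhds_zero_nat (𝕜 := ℝ)).const_mul 2
  refine tendsto_iff_norm_sub_tendsto_zero.2
    (squeeze_zero (fun _ => norm_nonneg _) (fun j => ?_) h2)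
  rw [hsum, cfcₙ_eq_cfc (hf.continuousOn) hf0, ← cfc_sub _ _ _ (by fun_prop) (by fun_prop)]
  refine norm_cfc_le (by positivity) fun x hx => ?_
  have hx0 : 0 ≤ x := spectrum_nonneg_of_nonneg ha hx
  have hxR : x ≤ R := (le_abs_self x).trans
    ((IsometricContinuousFunctionalCalculus.norm_spectrum_le a hx
      (IsSelfAdjoint.of_nonneg ha)).trans haR)
  have h3 := hp j x ⟨hx0, hxR⟩
  have h4 := hp j 0 ⟨le_rfl, hR⟩
  rw [hf0] at h4
  rw [abs_lt] at h3 h4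
  rw [Real.norm_eq_abs, abs_le]
  constructor <;> linarith

lemma dsum_pow {n m : ℕ} (a : M n A) (b : M m A) (k : ℕ) :
    dsum a b ^ (k + 1) = dsum (a ^ (k + 1)) (b ^ (k + 1)) := by
  induction k with
  | zero => simp
  | succ k ih =>
    rw [pow_succ, ih, pow_succ a, pow_succ b]
    exact dsum_mul _ _ _ _

lemma root_dsum {n m : ℕ} {a : M n A} {b : M m A} (ha : 0 ≤ a) (hb : 0 ≤ b) (k : ℕ) :
    root (k + 1) (dsum a b) = dsum (root (k + 1) a) (root (k + 1) b) := by
  refine root_eq_of_pow_eq (dsum_nonneg (root_nonneg _ _) (root_nonneg _ _)) ?_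
  rw [dsum_pow, root_pow ha, root_pow hb]

/-! ### The dimension function of a tracial state -/

lemma rect_mul_pow {n m : ℕ} (y : CStarMatrix (Fin m) (Fin n) A) (i : ℕ) :
    (y * (y.conjTranspose * y : M n A) ^ i : CStarMatrix (Fin m) (Fin n) A) =
      (y * y.conjTranspose : M m A) ^ i * y := by
  have key : ∀ y : Matrix (Fin m) (Fin n) A,
      y * (y.conjTranspose * y) ^ i = (y * y.conjTranspose) ^ i * y := by
    intro y
    induction i with
    | zero => simp
    | succ i ih =>
      rw [pow_succ, ← Matrix.mul_assoc, ih, pow_succ]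
      simp only [Matrix.mul_assoc]
  exact key y

namespace TracialState

variable (τ : TracialState A)

lemma tr_mul_comm {n m : ℕ} (v : CStarMatrix (Fin m) (Fin n) A)
    (w : CStarMatrix (Fin n) (Fin m) A) : τ.tr (w * v) = τ.tr (v * w) := by
  simp only [TracialState.tr, CStarMatrix.mul_apply, map_sum]
  rw [Finset.sum_comm]
  congr 1
  exact Finset.sum_congr rfl fun i _ => Finset.sum_congr rfl fun j _ => τ.2.2.2 _ _

lemma tr_pow_succ {n m : ℕ} (y : CStarMatrix (Fin m) (Fin n) A) (i : ℕ) :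
    τ.tr ((y.conjTranspose * y : M n A) ^ (i + 1)) =
      τ.tr ((y * y.conjTranspose : M m A) ^ (i + 1)) := by
  have h1 : (y.conjTranspose * y : M n A) ^ (i + 1) =
      y.conjTranspose * ((y * y.conjTranspose : M m A) ^ i * y) := by
    rw [← rect_mul_pow, pow_succ']
    exact rect_mul_assoc _ _ _
  have h2 : (y * y.conjTranspose : M m A) ^ (i + 1) =
      (y * y.conjTranspose : M m A) ^ i * y * y.conjTranspose := by
    rw [pow_succ]
    exact (rect_mul_assoc _ _ _).symm
  rw [h1, h2]
  exact τ.tr_mul_comm _ _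

lemma tr_zero {n : ℕ} : τ.tr (0 : M n A) = 0 := by simp [tr]

lemma tr_sum {n : ℕ} {ι : Type*} (s : Finset ι) (f : ι → M n A) :
    τ.tr (∑ i ∈ s, f i) = ∑ i ∈ s, τ.tr (f i) := by
  classical
  induction s using Finset.induction_on with
  | empty => simpa using τ.tr_zero
  | insert i s hi ih => rw [Finset.sum_insert hi, Finset.sum_insert hi, tr_add, ih]

lemma continuous_tr_apply {n : ℕ} : Continuous fun a : M n A => τ.tr a := by
  have key : Continuous fun a : Matrix (Fin n) (Fin n) A => (∑ i, τ.1 (a i i)).re := by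
    refine Complex.continuous_re.comp (continuous_finsetSum _ fun i _ => ?_)
    exact (show Continuous fun z : A => τ.1 z from (WeakDual.toStrongDual τ.1).continuous).comp
      (by fun_prop)
  exact key

/-- The trace agrees on the positive powers of `y* y` and `y y*`, hence on polynomials without
constant term, hence on roots by approximation with the same polynomials in both algebras. Constant
terms must be absent because the units have traces `n` and `m`. -/
lemma tr_root_conjTranspose_mul {n m : ℕ} (y : CStarMatrix (Fin m) (Fin n) A) (k : ℕ) :
    τ.tr (root (k + 1) (y.conjTranspose * y : M n A)) =
      τ.tr (root (k + 1) (y * y.conjTranspose : M m A)) := by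
  have h1 : (0 : M n A) ≤ y.conjTranspose * y := conjTranspose_mul_self_nonneg y
  have h2 : (0 : M m A) ≤ y * y.conjTranspose := by
    simpa only [rect_conjTranspose_conjTranspose] using
      conjTranspose_mul_self_nonneg y.conjTranspose
  have hk : (0 : ℝ) < 1 / ((k : ℝ) + 1) := by positivity
  obtain ⟨N, c, h⟩ := exists_polynomial_tendsto_cfcₙ (Real.continuous_rpow_const hk.le)
    (Real.zero_rpow hk.ne')
    (max ‖(y.conjTranspose * y : M n A)‖ ‖(y * y.conjTranspose : M m A)‖)
  have t1 := (τ.continuous_tr_apply.tendsto _).comp (h (M n A) _ h1 (le_max_left _ _))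
  have t2 := (τ.continuous_tr_apply.tendsto _).comp (h (M m A) _ h2 (le_max_right _ _))
  rw [root_eq_cfcₙ k h1, root_eq_cfcₙ k h2]
  refine tendsto_nhds_unique t1 (t2.congr fun j => ?_)
  simp only [Function.comp_apply, tr_sum, tr_smul, tr_pow_succ]

lemma d_zero {n : ℕ} : τ.d (0 : M n A) = 0 := by
  simp only [d, root_zero_right, tr_zero]
  exact tendsto_const_nhds.limUnder_eq

lemma tendsto_tr_root_d {n : ℕ} {a : M n A} (ha : 0 ≤ a) :
    Tendsto (fun k : ℕ => τ.tr (root k a)) atTop (𝓝 (τ.d a)) := by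
  by_cases h : a = 0
  · subst h
    rw [d_zero]
    simp only [root_zero_right, tr_zero]
    exact tendsto_const_nhds
  · rw [τ.d_eq ha h]
    exact τ.tendsto_tr_root ha h

lemma tendsto_tr_root_succ {n : ℕ} {a : M n A} (ha : 0 ≤ a) :
    Tendsto (fun k : ℕ => τ.tr (root (k + 1) a)) atTop (𝓝 (τ.d a)) :=
  (tendsto_add_atTop_iff_nat 1).2 (τ.tendsto_tr_root_d ha)

lemma tendsto_rpow_one_div {r : ℝ} (hr : r ≠ 0) :
    Tendsto (fun k : ℕ => r ^ (1 / ((k : ℝ) + 1))) atTop (𝓝 1) := by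
  simpa using (tendsto_const_nhds (x := r)).rpow
    (tendsto_one_div_add_atTop_nhds_zero_nat (𝕜 := ℝ)) (Or.inl hr)

lemma tr_root_le {n : ℕ} {a : M n A} (ha : 0 ≤ a) (k : ℕ) :
    τ.tr (root (k + 1) a) ≤ ‖a‖ ^ (1 / ((k : ℝ) + 1)) * τ.d a := by
  by_cases h : a = 0
  · subst h
    rw [d_zero, root_zero_right, tr_zero, mul_zero]
  · have hn : 0 < ‖a‖ := norm_pos_iff.2 h
    have h1 : τ.tr (nroot k a) ≤ τ.d a := by
      rw [τ.d_eq ha h]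
      exact le_ciSup (τ.bddAbove_nroot ha h) k
    rw [nroot, tr_smul, Real.rpow_neg hn.le] at h1
    rwa [inv_mul_le_iff₀ (by positivity)] at h1

/-- With `b = h²` and `y = h v*`, the element `v b v*` is `y* y`, while `y y* = h (v* v) h ≤ r b`.
Taking roots, the factor `r ^ (1 / (k + 1))` disappears in the limit. -/
lemma d_conj_le {n m : ℕ} {b : M m A} (hb : 0 ≤ b) (v : CStarMatrix (Fin n) (Fin m) A) :
    τ.d (v * b * v.conjTranspose : M n A) ≤ τ.d b := by
  obtain ⟨h, hh, hhb⟩ := exists_star_eq_mul_self hb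
  set y : CStarMatrix (Fin m) (Fin n) A := h * v.conjTranspose with hy
  have h1 : (v * b * v.conjTranspose : M n A) = y.conjTranspose * y := by
    rw [← hhb]
    exact mul_mul_conjTranspose_eq v h
  set g : M m A := v.conjTranspose * v with hg
  have hg0 : 0 ≤ g := conjTranspose_mul_self_nonneg v
  have h2 : (y * y.conjTranspose : M m A) = star h * g * h := by
    have hc : h.conjTranspose = h := hh
    have key : ∀ (h : Matrix (Fin m) (Fin m) A) (v : Matrix (Fin n) (Fin m) A),
        h * v.conjTranspose * (v * h) = h * (v.conjTranspose * v) * h := by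
      intro h v
      simp only [Matrix.mul_assoc]
    rw [hy, rect_conjTranspose_mul, rect_conjTranspose_conjTranspose, hc, hh, hg]
    exact key h v
  set r : ℝ := ‖g‖ + 1 with hr
  have hr0 : 0 < r := by positivity
  have h3 : (y * y.conjTranspose : M m A) ≤ (r : ℂ) • b := by
    rw [h2, ← hhb]
    exact star_mul_mul_le hg0 h
  have h4 : ∀ k : ℕ, τ.tr (root (k + 1) (v * b * v.conjTranspose : M n A)) ≤
      r ^ (1 / ((k : ℝ) + 1)) * τ.tr (root (k + 1) b) := by
    intro k
    rw [h1, tr_root_conjTranspose_mul, ← tr_smul, ← root_smul k hb hr0.le]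
    exact τ.tr_mono (root_mono k h3)
  have t := (tendsto_rpow_one_div hr0.ne').mul (τ.tendsto_tr_root_succ hb)
  rw [one_mul] at t
  exact le_of_tendsto_of_tendsto' (τ.tendsto_tr_root_succ (conj_nonneg v hb)) t h4

/-- Two limits are taken in order. For fixed `k`, the root of `a` is the limit of the roots of `v_j
b v_j*`, whose traces are at most `‖v_j b v_j*‖ ^ (1 / (k + 1)) * d_τ(b)`; then `k → ∞`. For `a = 0`
the norm factor does not tend to 1. -/
lemma d_mono {a b : Pos A} (h : CuntzLE a b) : τ.d (a.2 : M a.1 A) ≤ τ.d (b.2 : M b.1 A) := by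
  obtain ⟨n, a, ha⟩ := a
  obtain ⟨m, b, hb⟩ := b
  obtain ⟨v, hv⟩ := h
  change τ.d a ≤ τ.d b
  have hv' : Tendsto (fun j => (v j * b * (v j).conjTranspose : M n A)) atTop (𝓝 a) :=
    tendsto_iff_norm_sub_tendsto_zero.2 hv
  have h1 : ∀ k : ℕ, τ.tr (root (k + 1) a) ≤ ‖a‖ ^ (1 / ((k : ℝ) + 1)) * τ.d b := by
    intro k
    have t1 := (τ.continuous_tr_apply.tendsto _).comp
      (tendsto_root (k + 1) ha (fun j => conj_nonneg (v j) hb) hv')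
    have hk : (0 : ℝ) < 1 / ((k : ℝ) + 1) := by positivity
    have t2 := ((Real.continuous_rpow_const hk.le).tendsto _).comp hv'.norm
    refine le_of_tendsto_of_tendsto' t1 (t2.mul_const (τ.d b)) fun j => ?_
    refine (τ.tr_root_le (conj_nonneg (v j) hb) k).trans ?_
    exact mul_le_mul_of_nonneg_left (τ.d_conj_le hb (v j)) (Real.rpow_nonneg (norm_nonneg _) _)
  by_cases ha0 : a = 0
  · subst ha0
    rw [d_zero]
    exact ge_of_tendsto' (τ.tendsto_tr_root_d hb) fun k => τ.tr_nonneg (root_nonneg _ _)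
  · have t := (tendsto_rpow_one_div (norm_ne_zero_iff.2 ha0)).mul_const (τ.d b)
    rw [one_mul] at t
    exact le_of_tendsto_of_tendsto' (τ.tendsto_tr_root_succ ha) t h1

lemma tr_dsum {n m : ℕ} (a : M n A) (b : M m A) : τ.tr (dsum a b) = τ.tr a + τ.tr b := by
  have key : ∀ (a : Matrix (Fin n) (Fin n) A) (b : Matrix (Fin m) (Fin m) A),
      ∑ i, τ.1 ((Matrix.fromBlocks a 0 0 b).submatrix finSumFinEquiv.symm finSumFinEquiv.symm i i) =
        ∑ i, τ.1 (a i i) + ∑ i, τ.1 (b i i) := by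
    intro a b
    rw [← finSumFinEquiv.sum_comp, Fintype.sum_sum_type]
    simp
  rw [tr, tr, tr, ← Complex.add_re]
  exact congrArg Complex.re (key a b)

lemma d_dsum {n m : ℕ} {a : M n A} {b : M m A} (ha : 0 ≤ a) (hb : 0 ≤ b) :
    τ.d (dsum a b) = τ.d a + τ.d b := by
  refine tendsto_nhds_unique (τ.tendsto_tr_root_succ (dsum_nonneg ha hb)) ?_
  refine ((τ.tendsto_tr_root_succ ha).add (τ.tendsto_tr_root_succ hb)).congr fun k => ?_
  rw [root_dsum ha hb, tr_dsum]

lemma d_of_isStarProjection {n : ℕ} {p : M n A} (hp : IsStarProjection p) : τ.d p = τ.tr p := by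
  refine tendsto_nhds_unique (τ.tendsto_tr_root_succ hp.nonneg) ?_
  simp only [root_of_isStarProjection _ hp]
  exact tendsto_const_nhds

/-- The dimension function `d_τ` of a tracial state. -/
noncomputable def toDF : DF A :=
  ⟨Quotient.lift (fun a : Pos A => τ.d (a.2 : M a.1 A))
      fun _ _ h => le_antisymm (τ.d_mono h.1) (τ.d_mono h.2), by
    refine ⟨?_, ?_, ?_, ?_⟩
    · rintro ⟨a⟩
      exact ge_of_tendsto' (τ.tendsto_tr_root_d a.2.2) fun k => τ.tr_nonneg (root_nonneg _ _)
    · rintro ⟨a⟩ ⟨b⟩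
      exact τ.d_dsum a.2.2 b.2.2
    · rintro ⟨a⟩ ⟨b⟩ h
      exact τ.d_mono h
    · exact (τ.d_of_isStarProjection (IsStarProjection.one (M 1 A))).trans (by simp [tr_one])⟩

lemma toDF_mk {n : ℕ} {a : M n A} (ha : 0 ≤ a) : τ.toDF.1 (W.mk a ha) = τ.d a := rfl

/-- The extension of a tracial state to `Mₙ(A)`, as a complex valued function. -/
noncomputable def ctr {n : ℕ} (a : M n A) : ℂ := ∑ i, τ.1 (a i i)

lemma ctr_star_mul_self {n : ℕ} (x : M n A) :
    τ.ctr (star x * x) = ∑ i, ∑ j, τ.1 (star (x j i) * x j i) := by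
  simp [ctr, CStarMatrix.mul_apply, CStarMatrix.star_apply]

lemma ctr_star_mul_self_nonneg {n : ℕ} (x : M n A) : 0 ≤ τ.ctr (star x * x) := by
  rw [ctr_star_mul_self]
  exact Finset.sum_nonneg fun i _ => Finset.sum_nonneg fun j _ =>
    τ.2.1 _ (star_mul_self_nonneg _)

lemma ctr_eq_ofReal {n : ℕ} {a : M n A} (ha : 0 ≤ a) : τ.ctr a = ((τ.tr a : ℝ) : ℂ) := by
  obtain ⟨x, rfl⟩ := exists_eq_star_mul_self ha
  have h := Complex.nonneg_iff.1 (τ.ctr_star_mul_self_nonneg x)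
  exact Complex.ext rfl (by simpa using h.2.symm)

lemma isQuasitrace_ctr (n : ℕ) : IsQuasitrace (fun a : M n A => τ.ctr a) where
  nonneg := τ.ctr_star_mul_self_nonneg
  map_star_mul_self x := by
    simp only [ctr, CStarMatrix.mul_apply, map_sum]
    rw [Finset.sum_comm]
    exact Finset.sum_congr rfl fun i _ => Finset.sum_congr rfl fun j _ => τ.2.2.2 _ _
  linear_of_commutative S _ :=
    ⟨fun x _ y _ => by simp [ctr, Finset.sum_add_distrib], fun c x _ => by
      have h : ∀ i, τ.1 ((c • x) i i) = c * τ.1 (x i i) := fun i => by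
        rw [CStarMatrix.smul_apply, map_smul, smul_eq_mul]
      simp only [ctr, h, ← Finset.mul_sum]⟩
  map_add_I_smul x y _ _ := by
    have h : ∀ i, τ.1 ((x + Complex.I • y) i i) = τ.1 (x i i) + Complex.I * τ.1 (y i i) :=
      fun i => by
        rw [CStarMatrix.add_apply, CStarMatrix.smul_apply, map_add, map_smul, smul_eq_mul]
    simp only [ctr, h, Finset.sum_add_distrib, ← Finset.mul_sum]

lemma extends_ctr (n : ℕ) : Extends (fun a : M n A => τ.ctr a) τ.1 := by
  intro i a
  change ∑ j, τ.1 (Matrix.single i i a j j) = τ.1 a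
  rw [Finset.sum_eq_single i]
  · simp
  · intro j _ hj
    rw [Matrix.single_apply_of_row_ne (Ne.symm hj), map_zero]
  · simp

lemma isQuasitrace : IsQuasitrace (fun a : A => τ.1 a) where
  nonneg x := τ.2.1 _ (star_mul_self_nonneg x)
  map_star_mul_self x := τ.2.2.2 _ _
  linear_of_commutative S _ :=
    ⟨fun x _ y _ => map_add _ _ _, fun c x _ => by rw [map_smul, smul_eq_mul]⟩
  map_add_I_smul x y _ _ := by rw [map_add, map_smul, smul_eq_mul]

/-- The linear traces `ctr` on the matrix algebras provide the required extensions. -/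
lemma toDF_mem_LDF : τ.toDF ∈ LDF A := by
  refine ⟨fun a => τ.1 a, ⟨τ.isQuasitrace, τ.2.2.1, fun a => τ.ctr a, τ.isQuasitrace_ctr 2,
    τ.extends_ctr 2⟩, fun n => ⟨fun a => τ.ctr a, τ.isQuasitrace_ctr n, τ.extends_ctr n,
      fun a ha => ?_⟩⟩
  have h : (fun k : ℕ => τ.ctr (root k a)) = fun k => ((τ.tr (root k a) : ℝ) : ℂ) :=
    funext fun k => τ.ctr_eq_ofReal (root_nonneg k a)
  rw [h, toDF_mk]
  exact (Complex.continuous_ofReal.tendsto _).comp (τ.tendsto_tr_root_d ha)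

/-- A convex combination of tracial states. -/
noncomputable def mix (σ τ : TracialState A) (t : ℝ) (h0 : 0 ≤ t) (h1 : t ≤ 1) : TracialState A :=
  ⟨(t : ℂ) • σ.1 + ((1 - t : ℝ) : ℂ) • τ.1, by
    have e : ∀ x, ((t : ℂ) • σ.1 + ((1 - t : ℝ) : ℂ) • τ.1) x =
        (t : ℂ) * σ.1 x + ((1 - t : ℝ) : ℂ) * τ.1 x := fun _ => rfl
    refine ⟨fun a ha => ?_, ?_, fun a b => ?_⟩
    · rw [e]
      exact add_nonneg (mul_nonneg (by simpa using h0) (σ.2.1 a ha))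
        (mul_nonneg (Complex.zero_le_real.2 (sub_nonneg.2 h1)) (τ.2.1 a ha))
    · rw [e, σ.2.2.1, τ.2.2.1]
      push_cast
      ring
    · rw [e, e, σ.2.2.2, τ.2.2.2]⟩

lemma tr_mix (σ τ : TracialState A) {t : ℝ} (h0 : 0 ≤ t) (h1 : t ≤ 1) {n : ℕ} (a : M n A) :
    (mix σ τ t h0 h1).tr a = t * σ.tr a + (1 - t) * τ.tr a := by
  have e : ∀ x, (mix σ τ t h0 h1).1 x = (t : ℂ) * σ.1 x + ((1 - t : ℝ) : ℂ) * τ.1 x :=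
    fun _ => rfl
  simp only [TracialState.tr, e, Finset.sum_add_distrib, ← Finset.mul_sum, Complex.add_re,
    Complex.re_ofReal_mul]

lemma toDF_mix (σ τ : TracialState A) {t : ℝ} (h0 : 0 ≤ t) (h1 : t ≤ 1) (x : W A) :
    (mix σ τ t h0 h1).toDF.1 x = t * σ.toDF.1 x + (1 - t) * τ.toDF.1 x := by
  induction x using W.ind with
  | h n a ha =>
    simp only [toDF_mk]
    refine tendsto_nhds_unique ((mix σ τ t h0 h1).tendsto_tr_root_d ha) ?_
    exact (((σ.tendsto_tr_root_d ha).const_mul t).add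
      ((τ.tendsto_tr_root_d ha).const_mul (1 - t))).congr fun k => (tr_mix σ τ h0 h1 _).symm

end TracialState

/-! ### Simplicity -/

/-- A simple unital C⋆-algebra is algebraically simple. -/
lemma isSimpleRing [IsSimple A] : IsSimpleRing A := by
  have := IsSimple.nontrivial (A := A)
  refine IsSimpleRing.of_eq_bot_or_eq_top fun I => ?_
  let J : TwoSidedIdeal A := TwoSidedIdeal.mk' (closure (I : Set A))
    (subset_closure I.zero_mem)
    (fun hx hy => map_mem_closure₂ continuous_add hx hy fun _ ha _ hb => I.add_mem ha hb)
    (fun hx => map_mem_closure continuous_neg hx fun _ ha => I.neg_mem ha)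
    (fun {x y} hy => map_mem_closure (f := fun z => x * z) (by fun_prop) hy
      fun _ ha => I.mul_mem_left _ _ ha)
    (fun {x y} hx => map_mem_closure (f := fun z => z * y) (by fun_prop) hx
      fun _ ha => I.mul_mem_right _ _ ha)
  have hJ : (J : Set A) = closure (I : Set A) := Set.ext fun x => TwoSidedIdeal.mem_mk' ..
  rcases IsSimple.eq_bot_or_eq_top J (by rw [hJ]; exact isClosed_closure) with h | h
  · left
    rw [eq_bot_iff]
    intro x hx
    have : x ∈ (J : Set A) := by rw [hJ]; exact subset_closure hx
    rwa [h] at this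
  · right
    have h1 : (1 : A) ∈ closure (I : Set A) := by rw [← hJ, h]; trivial
    -- A dense ideal meets the open unit ball around 1, which consists of units.
    obtain ⟨x, hx, hx1⟩ := Metric.mem_closure_iff.1 h1 1 one_pos
    have hu : IsUnit x := by
      by_contra hu
      exact nonunits.subset_compl_ball hu (by rwa [Metric.mem_ball, dist_comm])
    obtain ⟨u, rfl⟩ := hu
    rw [← I.one_mem_iff]
    simpa using I.mul_mem_left (↑u⁻¹ : A) _ hx

lemma isSimpleRing_matrix [IsSimple A] : IsSimpleRing (M 1 A) :=
  haveI := isSimpleRing (A := A)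
  IsSimpleRing.matrix (Fin 1) A

/-! ### Sums of positive elements -/

lemma mk_le_of_le_smul' {n : ℕ} {a b : M n A} (ha : 0 ≤ a) (hb : 0 ≤ b) {r : ℝ} (hr : 0 ≤ r)
    (h : a ≤ (r : ℂ) • b) : W.mk a ha ≤ W.mk b hb :=
  mk_le_of_le_smul ha hb hr (h.trans_eq (Complex.coe_smul r b))

/-- Conjugating `a ⊕ b` by the row `(1 1)` gives `a + b`. -/
lemma mk_add_le {n : ℕ} {a b : M n A} (ha : 0 ≤ a) (hb : 0 ≤ b) :
    W.mk (a + b) (add_nonneg ha hb) ≤ W.mk a ha + W.mk b hb := by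
  have key : ∀ a b : Matrix (Fin n) (Fin n) A,
      (Matrix.fromCols (1 : Matrix (Fin n) (Fin n) A) (1 : Matrix (Fin n) (Fin n) A)).submatrix id
          finSumFinEquiv.symm *
        (Matrix.fromBlocks a 0 0 b).submatrix finSumFinEquiv.symm finSumFinEquiv.symm *
        ((Matrix.fromCols (1 : Matrix (Fin n) (Fin n) A) (1 : Matrix (Fin n) (Fin n) A)).submatrix
          id finSumFinEquiv.symm).conjTranspose = a + b := by
    intro a b
    rw [Matrix.submatrix_mul_equiv, Matrix.conjTranspose_submatrix, Matrix.submatrix_mul_equiv,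
      Matrix.conjTranspose_fromCols_eq_fromRows_conjTranspose, Matrix.fromCols_mul_fromBlocks,
      Matrix.fromCols_mul_fromRows]
    simp
  rw [mk_add_mk]
  exact mk_conj_le _ _ _ (key a b)

/-- Conjugating `z` by the column with entries `a` and `b` gives a `2 × 2` block matrix whose
off-diagonal blocks are the two products assumed to vanish. -/
lemma mk_add_mk_le {n : ℕ} {z : M n A} (hz : 0 ≤ z) {a b : M n A} (hab : a * z * star b = 0)
    (hba : b * z * star a = 0) (ha : 0 ≤ a * z * star a) (hb : 0 ≤ b * z * star b) :
    W.mk (a * z * star a) ha + W.mk (b * z * star b) hb ≤ W.mk z hz := by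
  have key : ∀ a b z : Matrix (Fin n) (Fin n) A, a * z * b.conjTranspose = 0 →
      b * z * a.conjTranspose = 0 →
      (Matrix.fromRows a b).submatrix finSumFinEquiv.symm id * z *
        ((Matrix.fromRows a b).submatrix finSumFinEquiv.symm id).conjTranspose =
      (Matrix.fromBlocks (a * z * a.conjTranspose) 0 0 (b * z * b.conjTranspose)).submatrix
        finSumFinEquiv.symm finSumFinEquiv.symm := by
    intro a b z h1 h2
    have e : (Matrix.fromRows a b).submatrix finSumFinEquiv.symm id * z =
        (Matrix.fromRows (a * z) (b * z)).submatrix finSumFinEquiv.symm id := by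
      rw [← Matrix.fromRows_mul]
      rfl
    have e' : ∀ (x : Matrix (Fin n ⊕ Fin n) (Fin n) A) (y : Matrix (Fin n) (Fin n ⊕ Fin n) A),
        x.submatrix (finSumFinEquiv (m := n) (n := n)).symm id *
          y.submatrix id (finSumFinEquiv (m := n) (n := n)).symm =
        (x * y).submatrix finSumFinEquiv.symm finSumFinEquiv.symm := fun _ _ => rfl
    rw [e, Matrix.conjTranspose_submatrix,
      Matrix.conjTranspose_fromRows_eq_fromCols_conjTranspose, e', Matrix.fromRows_mul_fromCols,
      h1, h2]
  rw [mk_add_mk]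
  exact mk_conj_le _ _ _ (key a b z hab hba)

/-! ### Faithfulness of dimension functions -/

section Generic

variable {B : Type*} [CStarAlgebra B] [PartialOrder B] [StarOrderedRing B]

lemma star_add_mul_add_le (x y : B) :
    star (x + y) * (x + y) ≤ ((2 : ℝ) : ℂ) • (star x * x + star y * y) := by
  have e : ((2 : ℝ) : ℂ) • (star x * x + star y * y) - star (x + y) * (x + y) =
      star (x - y) * (x - y) := by
    rw [Complex.coe_smul, two_smul]
    simp only [star_add, star_sub]
    noncomm_ring
  rw [← sub_nonneg, e]
  exact star_mul_self_nonneg _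

lemma star_mul_mul_mul_le (a x : B) :
    star (a * x) * (a * x) ≤ ((‖star a * a‖ + 1 : ℝ) : ℂ) • (star x * x) := by
  have := star_mul_mul_le (star_mul_self_nonneg a) x
  simpa [mul_assoc] using this

end Generic

namespace DF

variable (s : DF A)

lemma mk_zero {n : ℕ} : s.1 (W.mk (0 : M n A) le_rfl) = 0 := by
  have h : W.mk (0 : M n A) le_rfl + W.mk (0 : M n A) le_rfl ≤ W.mk (0 : M n A) le_rfl := by
    simpa using mk_add_mk_le (z := (0 : M n A)) le_rfl (a := 0) (b := 0) (by simp) (by simp)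
      (by simp) (by simp)
  have h1 := s.mono h
  rw [s.map_add] at h1
  linarith [s.nonneg (W.mk (0 : M n A) le_rfl)]

/-- The two-sided ideal of elements `x` such that `s ⟨x* x⟩ = 0`. -/
def ker : TwoSidedIdeal (M 1 A) :=
  TwoSidedIdeal.mk' {x | s.1 (W.mk (star x * x) (star_mul_self_nonneg x)) = 0}
    (by simpa using s.mk_zero)
    (by
      intro x y hx hy
      refine le_antisymm ?_ (s.nonneg _)
      have h := s.mono ((mk_le_of_le_smul' (star_mul_self_nonneg (x + y))
        (add_nonneg (star_mul_self_nonneg x) (star_mul_self_nonneg y)) zero_le_two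
        (star_add_mul_add_le x y)).trans
          (mk_add_le (star_mul_self_nonneg x) (star_mul_self_nonneg y)))
      rw [s.map_add] at h
      simp only [Set.mem_ofPred_eq] at hx hy
      linarith)
    (by intro x hx; simpa using hx)
    (by
      intro a x hx
      refine le_antisymm ?_ (s.nonneg _)
      have h := s.mono (mk_le_of_le_smul' (star_mul_self_nonneg (a * x)) (star_mul_self_nonneg x)
        (by positivity) (star_mul_mul_mul_le a x))
      simp only [Set.mem_ofPred_eq] at hx
      linarith)
    (by
      intro x a hx
      refine le_antisymm ?_ (s.nonneg _)
      have h := s.mono (mk_conj_le (star_mul_self_nonneg (x * a)) (star_mul_self_nonneg x) (star a)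
        (by
          change star a * (star x * x) * star (star a) = _
          simp [mul_assoc]))
      simp only [Set.mem_ofPred_eq] at hx
      linarith)

lemma mem_ker (x : M 1 A) :
    x ∈ s.ker ↔ s.1 (W.mk (star x * x) (star_mul_self_nonneg x)) = 0 :=
  TwoSidedIdeal.mem_mk' ..

/-- The elements `x` with `s ⟨x* x⟩ = 0` form an ideal that misses 1. It need not be closed, as `s`
is not assumed lower semicontinuous, so algebraic simplicity is what makes it zero. -/
lemma pos [IsSimple A] {c : M 1 A} (hc : 0 ≤ c) (hc0 : c ≠ 0) : 0 < s.1 (W.mk c hc) := by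
  refine lt_of_le_of_ne (s.nonneg _) fun h => ?_
  obtain ⟨x, rfl⟩ := exists_eq_star_mul_self hc
  have hx : x ≠ 0 := by rintro rfl; simp at hc0
  have := isSimpleRing_matrix (A := A)
  have h1 := IsSimpleRing.one_mem_of_ne_zero_mem s.ker hx ((s.mem_ker x).2 h.symm)
  rw [mem_ker] at h1
  have h2 : W.mk (star (1 : M 1 A) * 1) (star_mul_self_nonneg 1) = W.one A := by
    rw [W.one]
    congr 1
    simp
  rw [h2, s.map_one] at h1
  exact one_ne_zero h1

end DF

/-! ### Elements whose spectrum accumulates at zero -/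

section Generic

variable {B : Type*} [CStarAlgebra B] [PartialOrder B] [StarOrderedRing B]

/-- The spectrum of `z` contains arbitrarily small positive numbers. -/
def AccumulatesAtZero (z : B) : Prop := ∀ ε : ℝ, 0 < ε → ∃ t ∈ spectrum ℝ z, 0 < t ∧ t < ε

/-- Take `a = f(z)` and `b = g(z)`, where `f` vanishes up to `ε / 2` and is 1 from `ε` on, while `g`
is positive exactly below `ε / 2`. Cutting by `f` changes `z` by at most `ε`, and `b z b` sees the
spectrum in `(0, ε / 2)`. -/
lemma AccumulatesAtZero.exists_orthogonal {z : B} (hz : 0 ≤ z) (h : AccumulatesAtZero z) {ε : ℝ}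
    (hε : 0 < ε) : ∃ a b : B, star a = a ∧ star b = b ∧ a * z * b = 0 ∧ b * z * a = 0 ∧
      b * z * b ≠ 0 ∧ ‖a * z * a - z‖ ≤ ε := by
  let f : ℝ → ℝ := fun t => min 1 (max 0 (2 * t / ε - 1))
  let g : ℝ → ℝ := fun t => max 0 (ε / 2 - t)
  have hf : Continuous f := by fun_prop
  have hg : Continuous g := by fun_prop
  have hfg : ∀ t, f t * g t = 0 := by
    intro t
    rcases le_total t (ε / 2) with ht | ht
    · have : f t = 0 := by
        have h1 : 2 * t / ε - 1 ≤ 0 := by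
          rw [sub_nonpos, div_le_one hε]
          linarith
        simp [f, max_eq_left h1]
      rw [this, zero_mul]
    · have : g t = 0 := max_eq_left (by linarith)
      rw [this, mul_zero]
  have e : ∀ p q : ℝ → ℝ, Continuous p → Continuous q →
      cfc p z * z * cfc q z = cfc (fun t => p t * t * q t) z := by
    intro p q hp hq
    have h2 : cfc p z * z = cfc (fun t => p t * t) z := by
      rw [cfc_mul p (fun t => t) z (by fun_prop) (by fun_prop), cfc_id' ℝ z]
    rw [h2, ← cfc_mul _ _ z (by fun_prop) (by fun_prop)]
  refine ⟨cfc f z, cfc g z, (cfc_predicate f z).star_eq, (cfc_predicate g z).star_eq, ?_, ?_, ?_,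
    ?_⟩
  · rw [e f g hf hg, ← cfc_zero ℝ z]
    congr 1
    funext t
    simp only [Pi.zero_apply]
    linear_combination t * hfg t
  · rw [e g f hg hf, ← cfc_zero ℝ z]
    congr 1
    funext t
    simp only [Pi.zero_apply]
    linear_combination t * hfg t
  · rw [e g g hg hg]
    intro h0
    obtain ⟨t, ht, ht0, htε⟩ := h (ε / 2) (half_pos hε)
    have h1 := norm_apply_le_norm_cfc (fun t => g t * t * g t) z ht (by fun_prop)
    rw [h0, norm_zero, norm_le_zero_iff] at h1
    have h2 : 0 < g t := lt_max_of_lt_right (by linarith)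
    have : 0 < g t * t * g t := by positivity
    linarith
  · rw [e f f hf hf]
    nth_rewrite 2 [← cfc_id' ℝ z]
    rw [← cfc_sub _ _ z (by fun_prop) (by fun_prop)]
    refine norm_cfc_le hε.le fun t ht => ?_
    have ht0 : 0 ≤ t := spectrum_nonneg_of_nonneg hz ht
    have hf0 : 0 ≤ f t := le_min zero_le_one (le_max_left _ _)
    have hf1 : f t ≤ 1 := min_le_left _ _
    rw [Real.norm_eq_abs, abs_le]
    rcases le_total t ε with h1 | h1
    · constructor
      · nlinarith [mul_nonneg (mul_nonneg hf0 ht0) hf0]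
      · nlinarith [mul_nonneg hf0 ht0, mul_nonneg (mul_nonneg hf0 ht0) (sub_nonneg.2 hf1),
          mul_nonneg ht0 (sub_nonneg.2 hf1)]
    · have : f t = 1 := by
        have h2 : 1 ≤ 2 * t / ε - 1 := by
          rw [le_sub_iff_add_le, le_div_iff₀ hε]
          linarith
        exact min_eq_left (le_max_of_le_right h2)
      rw [this]
      constructor <;> linarith

lemma exists_conj_eq_of_norm_sub_lt {q r : B} (hq : IsStarProjection q) (hr : 0 ≤ r)
    (h : ‖r - q‖ < 1) : ∃ w : B, w * r * star w = q := by
  have hqs : star q = q := hq.isSelfAdjoint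
  have hqq : q * q = q := hq.isIdempotentElem
  have hq1 : 0 ≤ 1 - q := hq.one_sub.nonneg
  -- If `r` is close to `q`, then `q r q` is invertible in the corner at `q`; adding `1 - q` makes
  -- it invertible in `B`, and its inverse square root commutes with `q`.
  set u := q * r * q + (1 - q) with hu
  have hu0 : 0 ≤ u := by
    have := star_left_conjugate_nonneg hr q
    rw [hqs] at this
    exact add_nonneg this hq1
  have hu1 : IsUnit u := by
    by_contra hn
    refine nonunits.subset_compl_ball hn ?_
    rw [mem_ball_iff_norm]
    have e : u - 1 = q * (r - q) * q := by
      rw [hu, mul_sub, sub_mul, hqq, hqq]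
      abel
    rw [e]
    have hqn := IsStarProjection.norm_le q hq
    calc ‖q * (r - q) * q‖ ≤ ‖q‖ * ‖r - q‖ * ‖q‖ :=
          (norm_mul_le _ _).trans (by gcongr; exact norm_mul_le _ _)
      _ ≤ 1 * ‖r - q‖ * 1 := by gcongr
      _ < 1 := by simpa using h
  have hus : IsStrictlyPositive u := IsStrictlyPositive.iff_of_unital.2 ⟨hu0, hu1⟩
  have hqu : q * u = q * r * q := by
    rw [hu, mul_add, mul_sub, hqq, mul_one, sub_self, add_zero, ← mul_assoc, ← mul_assoc, hqq]
  have huq : u * q = q * r * q := by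
    rw [hu, add_mul, sub_mul, hqq, one_mul, sub_self, add_zero, mul_assoc, hqq]
  have hc : Commute u q := huq.trans hqu.symm
  set t := u ^ (-(1 / 2) : ℝ) with ht
  have htc : Commute t q := hc.cfc_nnreal _
  have hts : star t = t := (IsSelfAdjoint.of_nonneg CFC.rpow_nonneg).star_eq
  have h1 : t * u * t = 1 := CFC.conjugate_rpow_neg_one_half u
  refine ⟨t * q, ?_⟩
  rw [star_mul, hts, hqs]
  calc t * q * r * (q * t) = t * (q * r * q) * t := by noncomm_ring
    _ = t * q * u * t := by rw [← hqu]; noncomm_ring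
    _ = q * (t * u * t) := by rw [htc.eq]; noncomm_ring
    _ = q := by rw [h1, mul_one]

end Generic

/-- A projection is rigid: a single approximant at distance less than 1 suffices. This condition is
open in `b`, so it survives small perturbations. -/
lemma mk_le_mk_of_isStarProjection {l m : ℕ} {q : M l A} (hq : IsStarProjection q) {b : M m A}
    (hb : 0 ≤ b) (v : CStarMatrix (Fin l) (Fin m) A)
    (h : ‖(v * b * v.conjTranspose : M l A) - q‖ < 1) : W.mk q hq.nonneg ≤ W.mk b hb := by
  obtain ⟨w, hw⟩ := exists_conj_eq_of_norm_sub_lt hq (conj_nonneg v hb) h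
  exact (mk_conj_le hq.nonneg (conj_nonneg v hb) w hw).trans (mk_conj_le _ hb v rfl)

/-- If the sum were the class of a projection `q`, rigidity would give `⟨q⟩ ≤ ⟨a⟩ + ⟨a' z a'⟩` for a
slight cut-down of `z`. But `z` also dominates the orthogonal nonzero piece `b' z b'`, to which `s`
gives positive mass, so `s` would drop strictly. -/
lemma purelyPositive_add [IsSimple A] (s : DF A) {z : M 1 A} (hz : 0 ≤ z)
    (h : AccumulatesAtZero z) (y : W A) : (y + W.mk z hz).PurelyPositive := by
  induction y using W.ind with
  | h n a ha =>
  rintro ⟨⟨l, q, hq⟩, hqz⟩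
  change W.mk q hq.nonneg = _ at hqz
  have h1 := hqz.le
  rw [mk_add_mk, mk_le_mk_iff, Metric.mem_closure_iff] at h1
  obtain ⟨_, ⟨v, rfl⟩, hv⟩ := h1 1 one_pos
  rw [dist_comm, dist_eq_norm] at hv
  have hcont : Continuous fun x : M 1 A => ‖(v * dsum a x * v.conjTranspose : M l A) - q‖ :=
    (((continuous_mul_mul v).comp (continuous_dsum.comp
      (continuous_const.prodMk continuous_id))).sub continuous_const).norm
  obtain ⟨ε, hε, hball⟩ := Metric.isOpen_iff.1 (isOpen_Iio.preimage hcont) z hv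
  obtain ⟨a', b', ha', hb', hab, hba, hc, hx⟩ := h.exists_orthogonal hz (half_pos hε)
  have hx0 : 0 ≤ a' * z * star a' := star_right_conjugate_nonneg hz a'
  have hc0 : 0 ≤ b' * z * star b' := star_right_conjugate_nonneg hz b'
  have hle := mk_add_mk_le hz (by rw [hb', hab]) (by rw [ha', hba]) hx0 hc0
  have hq' : W.mk q hq.nonneg ≤ W.mk a ha + W.mk _ hx0 := by
    refine mk_le_mk_of_isStarProjection hq (dsum_nonneg ha hx0) v (hball ?_)
    rw [mem_ball_iff_norm, ha']
    exact hx.trans_lt (half_lt_self hε)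
  have h2 := s.pos hc0 (by rwa [hb'])
  have h3 := s.mono hle
  have h4 := s.mono hq'
  rw [hqz, s.map_add, s.map_add] at h4
  rw [s.map_add] at h3
  linarith

/-! ### Comparison of dimension functions -/

lemma iota_toFun [IsSimple A] {x : W A} (hx : x.PurelyPositive) (τ : TracialState A) :
    (iota x hx).toFun τ = τ.toDF.1 x := by
  conv_rhs => rw [← x.out_eq]
  rfl

lemma hat_mk_eq (p : Proj A) (τ : TracialState A) :
    V.hat (Quotient.mk _ p) τ = τ.toDF.1 p.toW :=
  (τ.d_of_isStarProjection p.2.2).symm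

/-- A purely positive class lies below every class which dominates it in all traces, if `φ` is an
order embedding. -/
lemma le_of_forall_toDF_le [IsSimple A] (hφ : ∀ x y : W A, phi x ≤ phi y ↔ x ≤ y) {x y : W A}
    (hx : x.PurelyPositive) (h : ∀ τ : TracialState A, τ.toDF.1 x ≤ τ.toDF.1 y) : x ≤ y := by
  rw [← hφ, phi, dif_neg hx, phi]
  -- Below either kind of element, an affine element needs only the non-strict pointwise inequality.
  split_ifs with hy
  · intro τ
    rw [iota_toFun, hat_mk_eq, hy.choose_spec]
    exact h τ
  · intro τ
    rw [iota_toFun hx]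
    exact (h τ).trans_eq (iota_toFun hy τ).symm

/-! ### Separation by Hahn–Banach -/

variable (A) in
/-- The differences of evaluation maps at classes in `W(A)`. -/
def evalSub : AddSubgroup (DF A → ℝ) where
  carrier := {g | ∃ x y : W A, ∀ s : DF A, g s = s.1 x - s.1 y}
  zero_mem' := ⟨W.one A, W.one A, fun s => (sub_self _).symm⟩
  add_mem' := by
    rintro g g' ⟨x, y, h⟩ ⟨x', y', h'⟩
    refine ⟨x + x', y + y', fun s => ?_⟩
    rw [Pi.add_apply, h, h', s.map_add, s.map_add]
    ring
  neg_mem' := by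
    rintro g ⟨x, y, h⟩
    refine ⟨y, x, fun s => ?_⟩
    rw [Pi.neg_apply, h]
    ring

lemma eval_mem_evalSub (x : W A) : (fun s : DF A => s.1 x) ∈ evalSub A :=
  ⟨x + W.one A, W.one A, fun s => by rw [s.map_add]; ring⟩

lemma one_mem_evalSub : (fun _ : DF A => (1 : ℝ)) ∈ evalSub A := by
  have h := eval_mem_evalSub (W.one A)
  have e : (fun s : DF A => s.1 (W.one A)) = fun _ => 1 := funext fun s => s.map_one
  rwa [e] at h

/-- A dimension function which is not a limit of the functions `d_τ` is separated from them by
two classes in `W(A)`. -/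
lemma exists_separating {s : DF A} (hs : s ∉ closure (Set.range (TracialState.toDF (A := A)))) :
    ∃ x y : W A, s.1 x < s.1 y ∧ ∀ τ : TracialState A, τ.toDF.1 y + 1 ≤ τ.toDF.1 x := by
  classical
  rw [closure_subtype, ← Set.mem_compl_iff] at hs
  -- A basic neighbourhood of `s` involves only the finitely many classes in `I`, so the separation
  -- takes place in `ℝ^I`.
  obtain ⟨I, u, hu, hI⟩ := isOpen_pi_iff.1 isClosed_closure.isOpen_compl _ hs
  let ev : DF A → (I → ℝ) := fun t i => t.1 i
  let K : Set (I → ℝ) := Set.range fun τ : TracialState A => ev τ.toDF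
  have hK : ev s ∉ closure K := by
    intro h
    obtain ⟨_, h1, τ, rfl⟩ := mem_closure_iff.1 h (Set.univ.pi fun i : I => u i)
      (isOpen_set_pi Set.finite_univ fun i _ => (hu i i.2).1) fun i _ => (hu i i.2).2
    have h2 : τ.toDF.1 ∈ (I : Set (W A)).pi u := fun x hx => h1 ⟨x, hx⟩ (Set.mem_univ _)
    exact hI h2 (subset_closure ⟨_, ⟨τ, rfl⟩, rfl⟩)
  have hKc : Convex ℝ K := by
    rintro _ ⟨σ, rfl⟩ _ ⟨τ, rfl⟩ a b ha hb hab
    refine ⟨σ.mix τ a ha (by linarith), funext fun i => ?_⟩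
    change (σ.mix τ a ha _).toDF.1 i = a * σ.toDF.1 i + b * τ.toDF.1 i
    rw [TracialState.toDF_mix, show 1 - a = b by linarith]
  obtain ⟨f, r, hfs, hfK⟩ := geometric_hahn_banach_point_closed hKc.closure isClosed_closure hK
  set c : I → ℝ := fun i => f fun j => if i = j then 1 else 0 with hc
  have hf : ∀ t : DF A, f (ev t) = ∑ i, c i * t.1 i := by
    intro t
    have := LinearMap.pi_apply_eq_sum_univ f.toLinearMap (ev t)
    simp only [smul_eq_mul] at this
    refine this.trans (Finset.sum_congr rfl fun i _ => ?_)
    exact mul_comm _ _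
  choose C hC using fun i : I => exists_forall_apply_le (i : W A)
  -- The scaled gap must cover the rounding of the coefficients (at most `∑ C i`), the rounding of
  -- `k` (at most 1) and the desired margin 1.
  obtain ⟨m, hm⟩ := exists_nat_gt ((∑ i, C i + 3) / (r - f (ev s)))
  rw [div_lt_iff₀ (sub_pos.2 hfs)] at hm
  -- Dimension functions are nonnegative, so rounding down only lowers the sum and keeps the upper
  -- bound at `s`.
  let c' : I → ℤ := fun i => ⌊m * c i⌋
  have hup : ∀ t : DF A, ∑ i, (c' i : ℝ) * t.1 i ≤ m * f (ev t) := by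
    intro t
    rw [hf, Finset.mul_sum]
    refine Finset.sum_le_sum fun i _ => ?_
    rw [← mul_assoc]
    exact mul_le_mul_of_nonneg_right (Int.floor_le _) (t.nonneg _)
  have hlow : ∀ t : DF A, m * f (ev t) - ∑ i, C i ≤ ∑ i, (c' i : ℝ) * t.1 i := by
    intro t
    rw [hf, Finset.mul_sum, ← Finset.sum_sub_distrib]
    refine Finset.sum_le_sum fun i _ => ?_
    have h1 : m * c i - 1 ≤ c' i := (Int.sub_one_lt_floor _).le
    have h2 := mul_le_mul_of_nonneg_right h1 (t.nonneg i)
    have h3 := hC i t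
    linarith
  -- The least integer strictly above `m * f (ev s)`; subtracting it makes the value at `s`
  -- negative.
  let k : ℤ := ⌊m * f (ev s)⌋ + 1
  have hk1 : m * f (ev s) < k := by
    simp [k]
  have hk2 : (k : ℝ) ≤ m * f (ev s) + 1 := by
    simpa [k] using Int.floor_le (m * f (ev s))
  have hmem : (∑ i, c' i • (fun t : DF A => t.1 i)) - k • (fun _ : DF A => (1 : ℝ)) ∈ evalSub A :=
    sub_mem (sum_mem fun i _ => zsmul_mem (eval_mem_evalSub _) _)
      (zsmul_mem one_mem_evalSub _)
  obtain ⟨x, y, hxy⟩ := hmem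
  have hxy' : ∀ t : DF A, ∑ i, (c' i : ℝ) * t.1 i - k = t.1 x - t.1 y := by
    intro t
    rw [← hxy t]
    simp
  refine ⟨x, y, ?_, fun τ => ?_⟩
  · have h1 := hxy' s
    have h2 := hup s
    linarith
  · have h1 := hxy' τ.toDF
    have h2 := hlow τ.toDF
    have h3 : (m : ℝ) * r ≤ m * f (ev τ.toDF) :=
      mul_le_mul_of_nonneg_left (hfK _ (subset_closure ⟨τ, rfl⟩)).le (Nat.cast_nonneg m)
    linarith

/-- Density in the presence of a positive element whose spectrum accumulates at zero. -/
lemma mem_closure_of_accumulatesAtZero [IsSimple A] (hφ : ∀ x y : W A, phi x ≤ phi y ↔ x ≤ y)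
    {z : M 1 A} (hz : 0 ≤ z) (h : AccumulatesAtZero z) (s : DF A) : s ∈ closure (LDF A) := by
  refine closure_mono ?_ (not_not.1 fun hs : s ∉ closure (Set.range TracialState.toDF) => ?_)
  · rintro _ ⟨τ, rfl⟩
    exact τ.toDF_mem_LDF
  · obtain ⟨x, y, hxy, hτ⟩ := exists_separating hs
    have h1 : y + W.mk z hz ≤ x := by
      refine le_of_forall_toDF_le hφ (purelyPositive_add s hz h y) fun τ => ?_
      -- This is where `z` must lie in `M₁(A)`: its dimension fits into the margin 1.
      have h2 : τ.toDF.1 (W.mk z hz) ≤ 1 :=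
        (τ.toDF.mono (mk_le_mk_one hz)).trans_eq τ.toDF.map_one
      rw [τ.toDF.map_add]
      linarith [hτ τ]
    have h3 := s.mono h1
    rw [s.map_add] at h3
    linarith [s.nonneg (W.mk z hz)]

/-! ### Algebras in which no spectrum accumulates at zero -/

section Generic

variable {B : Type*} [CStarAlgebra B] [PartialOrder B] [StarOrderedRing B]

/-- The gap above zero in the spectrum of `x* x` gives a generalised inverse `y = g(x* x) x*`, where
`g(t) = 1/t` on the nonzero spectrum. Then `y x` is the support projection of `x`. -/
lemma exists_support (h : ∀ z : B, 0 ≤ z → ¬ AccumulatesAtZero z) (x : B) :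
    ∃ y : B, IsStarProjection (y * x) ∧ x * (y * x) = x := by
  set z := star x * x with hz_def
  have hz : 0 ≤ z := star_mul_self_nonneg x
  have hzs : IsSelfAdjoint z := IsSelfAdjoint.of_nonneg hz
  have h1 := h z hz
  simp only [AccumulatesAtZero, not_forall, not_exists, not_and, not_lt] at h1
  obtain ⟨ε, hε, hsp⟩ := h1
  have hmax : ∀ t : ℝ, 0 < max t ε := fun t => lt_max_of_lt_right hε
  -- Continuous on all of `ℝ`, zero at 0 and equal to `1/t` for `t ≥ ε`.
  let g : ℝ → ℝ := fun t => t / max t ε ^ 2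
  have hg : Continuous g :=
    continuous_id.div (by fun_prop) fun t => (pow_pos (hmax t) 2).ne'
  have hgt : ∀ t ∈ spectrum ℝ z, t = 0 ∨ g t * t = 1 := by
    intro t ht
    rcases (spectrum_nonneg_of_nonneg hz ht).eq_or_lt with h0 | h0
    · exact Or.inl h0.symm
    · right
      have : max t ε = t := max_eq_left (hsp t ht h0)
      simp only [g, this]
      field_simp
  have hp : cfc g z * star x * x = cfc (fun t => g t * t) z := by
    rw [mul_assoc, ← hz_def, cfc_mul g (fun t => t) z (by fun_prop) (by fun_prop), cfc_id' ℝ z]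
  refine ⟨cfc g z * star x, ?_, ?_⟩
  · rw [hp]
    refine ⟨?_, cfc_predicate _ _⟩
    rw [IsIdempotentElem, ← cfc_mul _ _ z (by fun_prop) (by fun_prop)]
    refine cfc_congr fun t ht => ?_
    rcases hgt t ht with h0 | h0
    · simp [h0]
    · simp [h0]
  · rw [hp]
    set p := cfc (fun t => g t * t) z with hp_def
    have hps : star p = p := (cfc_predicate (R := ℝ) (fun t => g t * t) z).star_eq
    have hzp : z * p = z := by
      have e : z * p = cfc (fun t => t * (g t * t)) z := by
        rw [cfc_mul (fun t => t) _ z (by fun_prop) (by fun_prop), cfc_id' ℝ z]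
      rw [e]
      conv_rhs => rw [← cfc_id' ℝ z]
      refine cfc_congr fun t ht => ?_
      rcases hgt t ht with h0 | h0
      · simp [h0]
      · simp [h0]
    have h2 : star (x * p - x) * (x * p - x) = 0 := by
      have e : star (x * p - x) * (x * p - x) = p * (z * p - z) - (z * p - z) := by
        rw [star_sub, star_mul, hps, hz_def]
        noncomm_ring
      rw [e, hzp]
      simp
    exact sub_eq_zero.1 ((CStarRing.star_mul_self_eq_zero_iff _).1 h2)

/-- An increasing sequence of projections gives a positive element whose spectrum accumulates at
zero. -/
lemma accumulatesAtZero_of_projections {p q : ℕ → B} (hp : ∀ n, IsStarProjection (p n))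
    (hq : ∀ n, IsStarProjection (q n)) (hq0 : ∀ n, q n ≠ 0) (hpq : ∀ n, p n * q n = 0)
    (hsucc : ∀ n, p (n + 1) = p n + q n) : ∃ z : B, 0 ≤ z ∧ AccumulatesAtZero z := by
  have hqp : ∀ n, q n * p n = 0 := fun n => by
    have := congrArg star (hpq n)
    rwa [star_mul, (hp n).isSelfAdjoint.star_eq, (hq n).isSelfAdjoint.star_eq, star_zero] at this
  have hle : ∀ n k, q n * p (n + 1 + k) = q n := by
    intro n k
    induction k with
    | zero => rw [add_zero, hsucc, mul_add, hqp, zero_add, (hq n).isIdempotentElem.eq]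
    | succ k ih =>
      have h1 : q n * q (n + 1 + k) = 0 := by
        rw [← ih, mul_assoc, hpq, mul_zero]
      rw [← add_assoc, hsucc, mul_add, ih, h1, add_zero]
  have hlt : ∀ n m, n < m → q n * q m = 0 := by
    intro n m hnm
    obtain ⟨k, rfl⟩ := Nat.exists_eq_add_of_le (Nat.succ_le_of_lt hnm)
    rw [← hle n k, mul_assoc, Nat.succ_eq_add_one, hpq, mul_zero]
  have horth : ∀ n m, n ≠ m → q n * q m = 0 := by
    intro n m hnm
    rcases lt_or_gt_of_ne hnm with h | h
    · exact hlt n m h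
    · have := congrArg star (hlt m n h)
      rwa [star_mul, (hq n).isSelfAdjoint.star_eq, (hq m).isSelfAdjoint.star_eq, star_zero] at this
  have hsum : Summable fun n => (1 / 2 : ℝ) ^ n • q n := by
    refine Summable.of_norm_bounded summable_geometric_two fun n => ?_
    rw [norm_smul, Real.norm_of_nonneg (by positivity)]
    exact mul_le_of_le_one_right (by positivity) (IsStarProjection.norm_le _ (hq n))
  -- The `q n` are mutually orthogonal, so `z = ∑ 2⁻ⁿ q n` satisfies `z q n = 2⁻ⁿ q n`, which puts
  -- `2⁻ⁿ` in the spectrum.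
  refine ⟨∑' n, (1 / 2 : ℝ) ^ n • q n,
    tsum_nonneg fun n => smul_nonneg (by positivity) (hq n).nonneg, fun ε hε => ?_⟩
  obtain ⟨n, hn⟩ := exists_pow_lt_of_lt_one hε (by norm_num : (1 / 2 : ℝ) < 1)
  refine ⟨(1 / 2) ^ n, ?_, by positivity, hn⟩
  have hz : (∑' m, (1 / 2 : ℝ) ^ m • q m) * q n = (1 / 2 : ℝ) ^ n • q n := by
    rw [← hsum.tsum_mul_right, tsum_eq_single n]
    · rw [smul_mul_assoc, (hq n).isIdempotentElem.eq]
    · intro m hm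
      rw [smul_mul_assoc, horth m n hm, smul_zero]
  rw [spectrum.mem_iff]
  intro hu
  refine hq0 n (hu.mul_right_eq_zero.1 ?_)
  rw [sub_mul, hz, Algebra.algebraMap_eq_smul_one, smul_mul_assoc, one_mul, sub_self]

/-- Otherwise each projection `p` in the left ideal has some `x` in it with `x ≠ x p`. The support
projection of `x - x p` is in the ideal, nonzero and orthogonal to `p`. Adding it and iterating from
0 gives a strictly increasing sequence of projections. -/
lemma exists_projection_of_ideal (h : ∀ z : B, 0 ≤ z → ¬ AccumulatesAtZero z) (I : Ideal B) :
    ∃ p ∈ I, ∀ x ∈ I, x * p = x := by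
  by_contra! hI
  have hstep : ∀ p : {p : B // IsStarProjection p ∧ p ∈ I}, ∃ q : B, IsStarProjection q ∧ q ∈ I ∧
      q ≠ 0 ∧ (p : B) * q = 0 := by
    rintro ⟨p, hp, hpI⟩
    obtain ⟨x, hx, hxp⟩ := hI p hpI
    have hx' : x - x * p ∈ I := sub_mem hx (I.mul_mem_left x hpI)
    obtain ⟨y, hy, hxy⟩ := exists_support h (x - x * p)
    refine ⟨y * (x - x * p), hy, I.mul_mem_left y hx', ?_, ?_⟩
    · intro h0
      rw [h0, mul_zero] at hxy
      exact hxp (sub_eq_zero.1 hxy.symm).symm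
    · have h1 : y * (x - x * p) * p = 0 := by
        rw [mul_assoc, sub_mul, mul_assoc, hp.isIdempotentElem.eq, sub_self, mul_zero]
      have := congrArg star h1
      rwa [star_mul, hp.isSelfAdjoint.star_eq, hy.isSelfAdjoint.star_eq, star_zero] at this
  choose q hq hqI hq0 hpq using hstep
  have hadd : ∀ p : {p : B // IsStarProjection p ∧ p ∈ I}, IsStarProjection ((p : B) + q p) ∧
      (p : B) + q p ∈ I := by
    intro p
    refine ⟨?_, add_mem p.2.2 (hqI p)⟩
    exact p.2.1.add (hq p) (hpq p)
  let next : {p : B // IsStarProjection p ∧ p ∈ I} → {p : B // IsStarProjection p ∧ p ∈ I} :=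
    fun p => ⟨(p : B) + q p, hadd p⟩
  let P : ℕ → {p : B // IsStarProjection p ∧ p ∈ I} := fun n =>
    next^[n] ⟨0, IsStarProjection.zero B, zero_mem I⟩
  have hP : ∀ n, (P (n + 1) : B) = (P n : B) + q (P n) := fun n => by
    simp only [P, Function.iterate_succ_apply']
    rfl
  obtain ⟨z, hz, hz'⟩ := accumulatesAtZero_of_projections (p := fun n => (P n : B))
    (q := fun n => q (P n)) (fun n => (P n).2.1) (fun n => hq _) (fun n => hq0 _)
    (fun n => hpq _) hP
  exact h z hz hz'

/-- A left ideal generated by a projection `p` is complemented by the kernel of right multiplication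
by `p`. -/
lemma isSemisimpleRing_of_not_accumulatesAtZero (h : ∀ z : B, 0 ≤ z → ¬ AccumulatesAtZero z) :
    IsSemisimpleRing B := by
  have : ComplementedLattice (Ideal B) := by
    refine ⟨fun I => ?_⟩
    obtain ⟨p, hp, hI⟩ := exists_projection_of_ideal h I
    refine ⟨LinearMap.ker (LinearMap.toSpanSingleton B B p), ?_⟩
    rw [isCompl_iff, Submodule.disjoint_def, Submodule.codisjoint_iff_exists_add_eq]
    constructor
    · intro x hx hx'
      rw [LinearMap.mem_ker, LinearMap.toSpanSingleton_apply, smul_eq_mul, hI x hx] at hx'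
      exact hx'
    · intro x
      refine ⟨x * p, x - x * p, I.mul_mem_left x hp, ?_, by abel⟩
      rw [LinearMap.mem_ker, LinearMap.toSpanSingleton_apply, smul_eq_mul, sub_mul, mul_assoc,
        hI p hp, sub_self]
  exact (isSemisimpleModule_iff B B).2 this

/-- A simple C⋆-algebra in which no spectrum accumulates at zero is a matrix algebra. -/
lemma exists_algEquiv_matrix [IsSimpleRing B] (h : ∀ z : B, 0 ≤ z → ¬ AccumulatesAtZero z) :
    ∃ N : ℕ, NeZero N ∧ Nonempty (B ≃ₐ[ℂ] Matrix (Fin N) (Fin N) ℂ) := by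
  have := isSemisimpleRing_of_not_accumulatesAtZero h
  have := IsSimpleRing.isSemisimpleRing_iff_isArtinianRing.1 this
  obtain ⟨N, hN, D, _, _, ⟨e⟩⟩ := IsSimpleRing.exists_algEquiv_matrix_divisionRing ℂ B
  refine ⟨N, hN, ⟨?_⟩⟩
  -- Gelfand–Mazur. As `D` carries no norm, the nonempty spectrum is taken in `B`, at the scalar
  -- matrix of `d`.
  have hD : Function.Bijective (Algebra.ofId ℂ D) := by
    refine ⟨(algebraMap ℂ D).injective, fun d => ?_⟩
    obtain ⟨c, hc⟩ := spectrum.nonempty (e.symm (Matrix.scalar (Fin N) d))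
    refine ⟨c, ?_⟩
    by_contra hcd
    rw [spectrum.mem_iff] at hc
    refine hc ?_
    have hu : IsUnit (algebraMap ℂ D c - d) := isUnit_iff_ne_zero.2 (sub_ne_zero.2 hcd)
    have hu' := (hu.map (Matrix.scalar (Fin N))).map e.symm
    have e1 : Matrix.scalar (Fin N) (algebraMap ℂ D c) =
        algebraMap ℂ (Matrix (Fin N) (Fin N) D) c := rfl
    rwa [map_sub, map_sub, e1, AlgEquiv.commutes] at hu'
  exact e.trans (AlgEquiv.mapMatrix (AlgEquiv.ofBijective _ hD).symm)

end Generic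

/-! ### Matrix algebras -/

lemma rank_fromBlocks_zero {l m : Type*} [Fintype l] [Fintype m] [DecidableEq l] [DecidableEq m]
    (X : Matrix l l ℂ) (Y : Matrix m m ℂ) :
    (Matrix.fromBlocks X 0 0 Y).rank = X.rank + Y.rank := by
  let e := LinearEquiv.sumArrowLequivProdArrow l m ℂ ℂ
  have h : (Matrix.fromBlocks X 0 0 Y).mulVecLin =
      e.symm.toLinearMap ∘ₗ (X.mulVecLin.prodMap Y.mulVecLin) ∘ₗ e.toLinearMap := by
    refine LinearMap.ext fun v => ?_
    rw [Matrix.mulVecLin_apply, Matrix.fromBlocks_mulVec]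
    funext i
    rcases i with i | i
    · simp [e]
      rfl
    · simp [e]
      rfl
  rw [Matrix.rank, h, LinearMap.range_comp, LinearEquiv.finrank_map_eq, LinearMap.range_comp,
    LinearEquiv.range, Submodule.map_top, LinearMap.range_prodMap, Matrix.rank, Matrix.rank]
  let p := LinearMap.range X.mulVecLin
  let q := LinearMap.range Y.mulVecLin
  let e' : (p.prod q) ≃ₗ[ℂ] p × q :=
    { toFun := fun x => (⟨x.1.1, x.2.1⟩, ⟨x.1.2, x.2.2⟩)
      invFun := fun x => ⟨(x.1.1, x.2.1), x.1.2, x.2.2⟩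
      map_add' := fun _ _ => rfl
      map_smul' := fun _ _ => rfl
      left_inv := fun _ => rfl
      right_inv := fun _ => rfl }
  rw [e'.finrank_eq, Module.finrank_prod]

/-- The range of `X` embeds into that of `Y`. Lifting through `Y` gives `W`, and a left inverse of
the embedding gives `V`. -/
lemma exists_eq_mul_mul_of_rank_le {l m : Type*} [Fintype l] [Fintype m] [DecidableEq l]
    [DecidableEq m] {X : Matrix l l ℂ} {Y : Matrix m m ℂ} (h : X.rank ≤ Y.rank) :
    ∃ (V : Matrix l m ℂ) (W : Matrix m l ℂ), X = V * Y * W := by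
  set f := Matrix.toLin' X with hf
  set g := Matrix.toLin' Y with hg
  have h' : Module.finrank ℂ (LinearMap.range f) ≤ Module.finrank ℂ (LinearMap.range g) := h
  obtain ⟨i, hi⟩ := finrank_le_iff_exists_linearMap.1 h'
  obtain ⟨k, hk⟩ := g.rangeRestrict.exists_rightInverse_of_surjective g.range_rangeRestrict
  obtain ⟨r, hr⟩ := ((LinearMap.range g).subtype ∘ₗ i).exists_leftInverse_of_injective
    (LinearMap.ker_eq_bot.2 ((Submodule.injective_subtype _).comp hi))
  let v := (LinearMap.range f).subtype ∘ₗ r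
  let w := k ∘ₗ i ∘ₗ f.rangeRestrict
  have hvw : f = v ∘ₗ g ∘ₗ w := by
    refine LinearMap.ext fun x => ?_
    have h1 : g (w x) = (i (f.rangeRestrict x) : m → ℂ) :=
      congrArg Subtype.val (LinearMap.congr_fun hk (i (f.rangeRestrict x)))
    have h2 : r (i (f.rangeRestrict x) : m → ℂ) = f.rangeRestrict x :=
      LinearMap.congr_fun hr (f.rangeRestrict x)
    change f x = (r (g (w x)) : l → ℂ)
    rw [h1, h2]
    rfl
  refine ⟨LinearMap.toMatrix' v, LinearMap.toMatrix' w, ?_⟩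
  rw [← LinearMap.toMatrix'_toLin' X, ← hf, hvw, LinearMap.toMatrix'_comp,
    LinearMap.toMatrix'_comp, hg, LinearMap.toMatrix'_toLin', Matrix.mul_assoc]

/-- Since `ψ` need not preserve the involution, positivity of the normalised trace is read off from
spectra: `ψ a` has the spectrum of `a`, and its trace is the sum of its eigenvalues. -/
lemma nonempty_tracialState {N : ℕ} [NeZero N]
    (ψ : A ≃ₐ[ℂ] Matrix (Fin N) (Fin N) ℂ) : Nonempty (TracialState A) := by
  have : FiniteDimensional ℂ A := Module.Finite.equiv ψ.symm.toLinearEquiv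
  let L : A →ₗ[ℂ] ℂ := (N : ℂ)⁻¹ • (Matrix.traceLinearMap (Fin N) ℂ ℂ ∘ₗ ψ.toLinearMap)
  have hL : ∀ a, L a = (N : ℂ)⁻¹ * (ψ a).trace := fun _ => rfl
  refine ⟨⟨StrongDual.toWeakDual L.toContinuousLinearMap, fun a ha => ?_, ?_, fun a b => ?_⟩⟩
  · change 0 ≤ L a
    rw [hL]
    refine mul_nonneg (by rw [← Complex.ofReal_natCast, ← Complex.ofReal_inv,
      Complex.zero_le_real]; positivity) ?_
    rw [Matrix.trace_eq_sum_roots_charpoly]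
    refine Multiset.sum_nonneg fun c hc => ?_
    have hc' : c ∈ spectrum ℂ (ψ a) :=
      Matrix.mem_spectrum_iff_isRoot_charpoly.2 (Polynomial.isRoot_of_mem_roots hc)
    rw [AlgEquiv.spectrum_eq] at hc'
    exact spectrum_nonneg_of_nonneg ha hc'
  · change L 1 = 1
    rw [hL, map_one, Matrix.trace_one, Fintype.card_fin]
    exact inv_mul_cancel₀ (NeZero.ne _)
  · change L (a * b) = L (b * a)
    rw [hL, hL, map_mul, map_mul, Matrix.trace_mul_comm]

section FiniteDimensional

variable {N : ℕ} (ψ : A ≃ₐ[ℂ] Matrix (Fin N) (Fin N) ℂ)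

/-- The complex matrix of a matrix over an algebra which is isomorphic to a matrix algebra. -/
def complexMatrix {n m : ℕ} (x : CStarMatrix (Fin n) (Fin m) A) :
    Matrix (Fin n × Fin N) (Fin m × Fin N) ℂ :=
  Matrix.of fun i j => ψ (x i.1 j.1) i.2 j.2

lemma complexMatrix_mul {l n m : ℕ} (x : CStarMatrix (Fin l) (Fin n) A)
    (y : CStarMatrix (Fin n) (Fin m) A) :
    complexMatrix ψ (x * y) = complexMatrix ψ x * complexMatrix ψ y := by
  ext i j
  simp only [complexMatrix, Matrix.of_apply, CStarMatrix.mul_apply, map_sum, map_mul,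
    Matrix.sum_apply, Matrix.mul_apply, Fintype.sum_prod_type]

lemma complexMatrix_injective {n m : ℕ} :
    Function.Injective (complexMatrix ψ : CStarMatrix (Fin n) (Fin m) A → _) := by
  intro x y h
  ext i j
  refine ψ.injective (Matrix.ext fun k l => ?_)
  exact congrFun (congrFun h (i, k)) (j, l)

lemma complexMatrix_surjective {n m : ℕ} :
    Function.Surjective (complexMatrix ψ : CStarMatrix (Fin n) (Fin m) A → _) := by
  intro Y
  refine ⟨CStarMatrix.ofMatrix fun i j => ψ.symm (Matrix.of fun k l => Y (i, k) (j, l)), ?_⟩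
  ext ⟨i, k⟩ ⟨j, l⟩
  change ψ (ψ.symm (Matrix.of fun k l => Y (i, k) (j, l))) k l = _
  rw [AlgEquiv.apply_symm_apply]
  rfl

lemma complexMatrix_one {n : ℕ} : complexMatrix ψ (1 : M n A) = 1 := by
  ext ⟨i, k⟩ ⟨j, l⟩
  change ψ ((1 : M n A) i j) k l = _
  rw [CStarMatrix.one_apply]
  by_cases hij : i = j
  · subst hij
    simp [Matrix.one_apply]
  · simp [hij]

lemma rank_complexMatrix_dsum {n m : ℕ} (a : M n A) (b : M m A) :
    (complexMatrix ψ (dsum a b)).rank =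
      (complexMatrix ψ a).rank + (complexMatrix ψ b).rank := by
  let e : Fin (n + m) × Fin N ≃ (Fin n × Fin N) ⊕ (Fin m × Fin N) :=
    (finSumFinEquiv.symm.prodCongr (Equiv.refl _)).trans (Equiv.sumProdDistrib _ _ _)
  have key : complexMatrix ψ (dsum a b) =
      (Matrix.fromBlocks (complexMatrix ψ a) 0 0 (complexMatrix ψ b)).submatrix e e := by
    ext ⟨i, k⟩ ⟨j, l⟩
    obtain ⟨i, rfl⟩ := finSumFinEquiv.surjective i
    obtain ⟨j, rfl⟩ := finSumFinEquiv.surjective j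
    change ψ ((Matrix.fromBlocks (CStarMatrix.ofMatrix.symm a) 0 0
      (CStarMatrix.ofMatrix.symm b)) (finSumFinEquiv.symm (finSumFinEquiv i))
      (finSumFinEquiv.symm (finSumFinEquiv j))) k l = _
    rw [Equiv.symm_apply_apply, Equiv.symm_apply_apply]
    rcases i with i | i <;> rcases j with j | j <;>
      simp [e, complexMatrix]
  rw [key, Matrix.rank_submatrix, rank_fromBlocks_zero]

/-- Square roots are compared because `ψ` need not preserve adjoints. The factorisation `√a = v √b
w` is purely algebraic and pulls back to `A`; then `a = √a √a* = v √b (w w*) √b v*`, and the middle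
part is at most a multiple of `b`. -/
lemma mk_le_mk_of_rank_le {n m : ℕ} {a : M n A} (ha : 0 ≤ a) {b : M m A} (hb : 0 ≤ b)
    (h : (complexMatrix ψ (root 2 a)).rank ≤ (complexMatrix ψ (root 2 b)).rank) :
    W.mk a ha ≤ W.mk b hb := by
  obtain ⟨V, W', hVW⟩ := exists_eq_mul_mul_of_rank_le h
  obtain ⟨v, rfl⟩ := complexMatrix_surjective ψ V
  obtain ⟨w, rfl⟩ := complexMatrix_surjective ψ W'
  rw [← complexMatrix_mul, ← complexMatrix_mul] at hVW
  have hr := complexMatrix_injective ψ hVW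
  have hsa : star (root 2 a) = root 2 a := (IsSelfAdjoint.of_nonneg (root_nonneg 2 a)).star_eq
  have hsb : star (root 2 b) = root 2 b := (IsSelfAdjoint.of_nonneg (root_nonneg 2 b)).star_eq
  have haa : root 2 a * star (root 2 a) = a := by
    rw [hsa, ← pow_two]
    exact root_pow (k := 1) ha
  have hbb : star (root 2 b) * root 2 b = b := by
    rw [hsb, ← pow_two]
    exact root_pow (k := 1) hb
  have hg : (0 : M m A) ≤ w * w.conjTranspose := by
    simpa only [rect_conjTranspose_conjTranspose] using
      conjTranspose_mul_self_nonneg w.conjTranspose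
  set c : M m A := star (root 2 b) * (w * w.conjTranspose : M m A) * root 2 b with hc
  have hc0 : 0 ≤ c := star_left_conjugate_nonneg hg _
  have h1 : (v * c * v.conjTranspose : M n A) = a := by
    have key : ∀ (r : Matrix (Fin n) (Fin n) A) (v : Matrix (Fin n) (Fin m) A)
        (t : Matrix (Fin m) (Fin m) A) (w : Matrix (Fin m) (Fin n) A), r = v * t * w →
        t.conjTranspose = t →
        v * (t.conjTranspose * (w * w.conjTranspose) * t) * v.conjTranspose =
          r * r.conjTranspose := by
      rintro _ v t w rfl ht
      simp only [Matrix.conjTranspose_mul, Matrix.mul_assoc, ht]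
    exact (key _ v (root 2 b : M m A) w hr hsb).trans haa
  have h2 : c ≤ ((‖(w * w.conjTranspose : M m A)‖ + 1 : ℝ) : ℂ) • b :=
    (star_mul_mul_le hg (root 2 b)).trans_eq (by rw [hbb])
  exact (mk_conj_le ha hc0 v h1).trans (mk_le_of_le_smul' hc0 hb (by positivity) h2)

/-- The class `x` is represented by an element of rank `r`. -/
def HasRank (x : W A) (r : ℕ) : Prop :=
  ∃ (n : ℕ) (a : M n A) (ha : 0 ≤ a), x = W.mk a ha ∧ (complexMatrix ψ (root 2 a)).rank = r

lemma exists_hasRank (x : W A) : ∃ r, HasRank ψ x r := by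
  induction x using W.ind with
  | h n a ha => exact ⟨_, n, a, ha, rfl, rfl⟩

variable {ψ} in
lemma HasRank.le {x y : W A} {r t : ℕ} (hx : HasRank ψ x r) (hy : HasRank ψ y t) (h : r ≤ t) :
    x ≤ y := by
  obtain ⟨n, a, ha, rfl, rfl⟩ := hx
  obtain ⟨m, b, hb, rfl, rfl⟩ := hy
  exact mk_le_mk_of_rank_le ψ ha hb h

variable {ψ} in
lemma HasRank.add {x y : W A} {r t : ℕ} (hx : HasRank ψ x r) (hy : HasRank ψ y t) :
    HasRank ψ (x + y) (r + t) := by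
  obtain ⟨n, a, ha, rfl, rfl⟩ := hx
  obtain ⟨m, b, hb, rfl, rfl⟩ := hy
  refine ⟨n + m, dsum a b, dsum_nonneg ha hb, rfl, ?_⟩
  rw [root_dsum ha hb 1, rank_complexMatrix_dsum]

lemma hasRank_one : HasRank ψ (W.one A) N := by
  refine ⟨1, 1, zero_le_one, rfl, ?_⟩
  rw [root_of_isStarProjection 1 (IsStarProjection.one (M 1 A)), complexMatrix_one,
    Matrix.rank_one]
  simp

/-- The sum of `k + 1` copies of `x`. -/
def copies (x : W A) : ℕ → W A
  | 0 => x
  | k + 1 => copies x k + x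

variable {ψ} in
lemma HasRank.copies {x : W A} {r : ℕ} (hx : HasRank ψ x r) (k : ℕ) :
    HasRank ψ (copies x k) ((k + 1) * r) := by
  induction k with
  | zero => simpa [Cuntz.copies] using hx
  | succ k ih =>
    rw [add_mul (k + 1), one_mul]
    exact ih.add hx

lemma DF.copies (s : DF A) (x : W A) (k : ℕ) : s.1 (copies x k) = (k + 1) * s.1 x := by
  induction k with
  | zero => simp [Cuntz.copies]
  | succ k ih =>
    rw [Cuntz.copies, s.map_add, ih]
    push_cast
    ring

-- Both `N x + ⟨1⟩` and `(r + 1) ⟨1⟩` have rank `N r + N`, so they are equal in `W(A)`. The extra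
-- unit covers `r = 0`, as `copies` counts from one copy.
variable {ψ} in
lemma HasRank.apply_eq [NeZero N] {x : W A} {r : ℕ} (hx : HasRank ψ x r) (s : DF A) :
    N * s.1 x = r := by
  obtain ⟨K, rfl⟩ := Nat.exists_eq_succ_of_ne_zero (NeZero.ne N)
  have h1 := (hx.copies K).add (hasRank_one ψ)
  have h2 := (hasRank_one ψ).copies r
  have e : (K + 1) * r + (K + 1) = (r + 1) * (K + 1) := by ring
  have h3 : s.1 (Cuntz.copies x K + W.one A) = s.1 (Cuntz.copies (W.one A) r) :=
    le_antisymm (s.mono (h1.le h2 e.le)) (s.mono (h2.le h1 e.ge))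
  rw [s.map_add, s.copies, s.copies, s.map_one] at h3
  push_cast
  linarith

end FiniteDimensional

/-- A matrix algebra has a unique dimension function. -/
lemma DF.eq_of_algEquiv_matrix {N : ℕ} [NeZero N]
    (ψ : A ≃ₐ[ℂ] Matrix (Fin N) (Fin N) ℂ) (s t : DF A) : s = t := by
  refine Subtype.ext (funext fun x => ?_)
  obtain ⟨r, hr⟩ := exists_hasRank ψ x
  have hN : (N : ℝ) ≠ 0 := NeZero.ne _
  exact mul_left_cancel₀ hN ((hr.apply_eq s).trans (hr.apply_eq t).symm)

end Cuntz

/-! ### The density theorem -/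

theorem mainTheorem2 {A : Type*} [CStarAlgebra A] [PartialOrder A] [StarOrderedRing A]
    [Cuntz.IsSimple A] (hexact : Cuntz.IsExact A) (hfin : Cuntz.IsStablyFinite A)
    (hφ : ∀ x y : Cuntz.W A, Cuntz.phi x ≤ Cuntz.phi y ↔ x ≤ y) :
    Dense (Cuntz.LDF A) := by
  intro s
  by_cases h : ∃ z : Cuntz.M 1 A, 0 ≤ z ∧ Cuntz.AccumulatesAtZero z
  · obtain ⟨z, hz, hz'⟩ := h
    exact Cuntz.mem_closure_of_accumulatesAtZero hφ hz hz' s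
  · push Not at h
    have := Cuntz.isSimpleRing_matrix (A := A)
    obtain ⟨N, hN, ⟨ψ⟩⟩ := Cuntz.exists_algEquiv_matrix h
    let ψ' : A ≃ₐ[ℂ] Matrix (Fin N) (Fin N) ℂ :=
      (AlgEquiv.ofRingEquiv (f := (CStarMatrix.toOneByOne (Fin 1) ℂ A).toRingEquiv) fun c => by
        ext i j
        rw [Subsingleton.elim i j, CStarMatrix.algebraMap_apply, if_pos rfl]
        rfl).trans ψ
    obtain ⟨τ⟩ := Cuntz.nonempty_tracialState ψ'
    rw [Cuntz.DF.eq_of_algEquiv_matrix ψ' s τ.toDF]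
    exact subset_closure τ.toDF_mem_LDF
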